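/- **Theorem 1.** *Model (stable marriage with incomplete and weak preferences).* There are men $p_1,\dots,p_m$ and women $q_1,\dots,q_n$ ($m,n\ge 0$). Each man $p$ has a total, transitive relation $\succeq_p$ on $\{q_1,\dots,q_n\}\cup\{\varnothing\}$ and each woman $q$ a total, transitive relation $\succeq_q$ on $\{p_1,\dots,p_m\}\cup\{\varnothing\}$, where $\varnothing$ means being unmatched; $\succ$ denotes the asymmetric part. A matching $\mu$ maps each man to a woman or $\varnothing$, no woman being the image of two men; $\mu(q)$ denotes the partner of a woman $q$ ($\varnothing$ if there is none). It is *weakly stable* if $\mu(p)=q$ implies $q\succeq_p\varnothing$ and $p\succeq_q\varnothing$, and there is no pair $(p,q)$ with $q\succ_p\mu(p)$ and $p\succ_q\mu(q)$. It is *Pareto-optimal* if there is no matching $\mu'$ that every agent finds at least as good as $\mu$ while some agent does not find $\mu$ at least as good as $\mu'$. It is *Pareto-stable* if it is both. *Auctions.* A bidder has an integer ID, a real priority, and a bid, i.e. a partial function from the finite item set $V$ to $\mathbb R$. A finite set $U$ of bidders with distinct IDs defines a bipartite graph in which $u\in U$ and $v\in V$ are joined by an edge of weight $x$ when $u$ bids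 $x$ on $v$. A *maximum-weight matching* (MWM) is a matching (not necessarily perfect) of maximum total weight. Call $S\subseteq U$ *independent* if some MWM matches all of $S$; an MWM is *greedy* if the set of bidders it matches is, among the maximal independent sets, one of maximum total priority. A multibidder is a finite sequence of bidders with a common priority; distinct multibidders have distinct priorities, and all bidders have distinct IDs. The procedure ToUap on a finite set $T$ of multibidders starts with $U=\emptyset$ and, as long as there is a *ready* bidder, adds an arbitrary one to $U$; a bidder $u$ is ready if it is the first bidder not yet in $U$ of its multibidder and no greedy MWM of the graph of $U$ matches a bidder with the priority of $u$. It returns the final $U$. *Algorithm.* A utility assignment turns the preferences of the women (but not those of the men) into functions $\psi_q:\{p_1,\dots,p_m\}\cup\{\varnothing\}\to\mathbb R$ with $\psi_q(\varnothing)=0$ and $a\succeq_q b\iff\psi_q(a)\ge\psi_q(b)$. Given a utility assignment and the preferences: take an item for each woman and a dummy item for each man. For each man $p_i$, split $\{q_1,\dots,q_n\}\cup\{\varnothing\}$ into tiers (indifference classes of $\succeq_{p_i}$), best first, and form a multibidder of priority $i$ whose $k$-th bidder bids $\psi_{q}(p_i)$ on the item of each woman $q$ in the $k$-th tier, and $0$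 on the dummy item of $p_i$ if $\varnothing$ is in the $k$-th tier. Run ToUap on these $m$ multibidders, take any greedy MWM $M_0$ of the graph of the returned set, and output the $\mu$ such that $\mu(p_i)=q$ if and only if $M_0$ matches a bidder of $p_i$ to the item of $q$, and $\mu(p_i)=\varnothing$ if and only if $M_0$ matches a bidder of $p_i$ to the dummy item of $p_i$. *Claim.* Utility assignments exist, and for every fixed utility assignment: (a) on every input, every execution of ToUap terminates, the graph of the returned set has a greedy MWM, and for every greedy MWM $M_0$ the output $\mu$ is well defined, i.e. there is exactly one such matching; (b) every output is Pareto-stable; (c) the algorithm is strategyproof for the men: if $\mu$ is an output on some input, and $\mu'$ is an output on the input obtained by replacing only the preference relation $\succeq_p$ of one man $p$ by any total, transitive relation $\succeq'_p$, then $\mu(p)\succeq_p\mu'(p)$. In (b) and (c) this holds whatever arbitrary choices are made in the executions. -/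

import Mathlib

namespace SMIW

/-! ### Unit-demand auctions with priorities -/

/-- A bidder for the set of items `V`: an integer ID, a unit-demand bid (a partial function from
items to real offers), and a real priority. -/
structure Bidder (V : Type*) where
  id : ℤ
  bid : V → Option ℝ
  priority : ℝ

noncomputable instance (V : Type*) : DecidableEq (Bidder V) := Classical.decEq _

/-- The weight `w(u, v)` of an edge `(u, v)`. It is only used when `v` is in the domain of the bid
of `u`. -/
def Bidder.weight {V : Type*} (u : Bidder V) (v : V) : ℝ := (u.bid v).getD 0

/-- A unit-demand auction with priorities: a finite set of bidders for `V` with distinct IDs. -/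
structure UAP (V : Type*) where
  bidders : Finset (Bidder V)
  id_inj : ∀ u ∈ bidders, ∀ u' ∈ bidders, u.id = u'.id → u = u'

namespace UAP

variable {V : Type*}

/-- `M` is a matching of the bipartite graph of `A`, whose edges are the pairs `(u, v)` such that
`u` is a bidder of `A` that makes an offer for `v`. -/
structure IsMatching (A : UAP V) (M : Finset (Bidder V × V)) : Prop where
  edge : ∀ e ∈ M, e.1 ∈ A.bidders ∧ (e.1.bid e.2).isSome
  bidder_inj : ∀ e ∈ M, ∀ e' ∈ M, e.1 = e'.1 → e = e'
  item_inj : ∀ e ∈ M, ∀ e' ∈ M, e.2 = e'.2 → e = e'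

/-- The total weight of a set of edges. -/
def weight (M : Finset (Bidder V × V)) : ℝ := ∑ e ∈ M, e.1.weight e.2

/-- The set of bidders matched in `M`. -/
noncomputable def matched (M : Finset (Bidder V × V)) : Finset (Bidder V) := M.image Prod.fst

/-- `M` is a maximum-weight matching (MWM) of `A`. -/
def IsMWM (A : UAP V) (M : Finset (Bidder V × V)) : Prop :=
  A.IsMatching M ∧ ∀ M', A.IsMatching M' → weight M' ≤ weight M

/-- The independent sets of the matroid of `A`: sets of bidders that are simultaneously matched by
some MWM of `A`. -/
def Indep (A : UAP V) (S : Finset (Bidder V)) : Prop :=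
  S ⊆ A.bidders ∧ ∃ M, A.IsMWM M ∧ S ⊆ matched M

/-- The priority of a set of bidders. -/
def setPriority (S : Finset (Bidder V)) : ℝ := ∑ u ∈ S, u.priority

/-- `M` is a greedy MWM of `A`: an MWM whose set of matched bidders is a maximum-priority maximal
independent set of the matroid of `A`. -/
def IsGreedyMWM (A : UAP V) (M : Finset (Bidder V × V)) : Prop :=
  A.IsMWM M ∧ Maximal A.Indep (matched M) ∧
    ∀ S, Maximal A.Indep S → setPriority S ≤ setPriority (matched M)

/-- The number of bidders with priority `z` that are matched in `M`. -/
noncomputable def priorityCount (M : Finset (Bidder V × V)) (z : ℝ) : ℕ :=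
  ((matched M).filter (fun u => u.priority = z)).card

end UAP

/-! ### Iterated unit-demand auctions with priorities -/

/-- A multibidder: a finite sequence of bidders with distinct IDs and a common priority. -/
structure Multibidder (V : Type*) where
  seq : List (Bidder V)
  priority : ℝ
  priority_eq : ∀ u ∈ seq, u.priority = priority
  ids_nodup : (seq.map Bidder.id).Nodup

noncomputable instance (V : Type*) : DecidableEq (Multibidder V) := Classical.decEq _

/-- The set of bidders of a multibidder. -/
noncomputable def Multibidder.bidders {V : Type*} (t : Multibidder V) : Finset (Bidder V) :=
  t.seq.toFinset

/-- An iterated UAP: a finite set of multibidders such that distinct multibidders have distinct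
priorities, and bidders of distinct multibidders have distinct IDs. -/
structure IUAP (V : Type*) where
  multibidders : Finset (Multibidder V)
  priority_ne : ∀ t ∈ multibidders, ∀ t' ∈ multibidders, t ≠ t' → t.priority ≠ t'.priority
  id_ne : ∀ t ∈ multibidders, ∀ t' ∈ multibidders, t ≠ t' →
    ∀ u ∈ t.seq, ∀ u' ∈ t'.seq, u.id ≠ u'.id

namespace IUAP

variable {V : Type*}

/-- The set of all bidders of an IUAP. -/
noncomputable def bidders (B : IUAP V) : Finset (Bidder V) :=
  B.multibidders.biUnion Multibidder.bidders

theorem mem_bidders {B : IUAP V} {u : Bidder V} :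
    u ∈ B.bidders ↔ ∃ t ∈ B.multibidders, u ∈ t.seq := by
  simp [bidders, Multibidder.bidders]

theorem eq_of_id_eq (B : IUAP V) {u u' : Bidder V} (hu : u ∈ B.bidders) (hu' : u' ∈ B.bidders)
    (h : u.id = u'.id) : u = u' := by
  obtain ⟨t, ht, hut⟩ := mem_bidders.1 hu
  obtain ⟨t', ht', hut'⟩ := mem_bidders.1 hu'
  by_cases htt : t = t'
  · subst htt
    exact List.inj_on_of_nodup_map t.ids_nodup hut hut' h
  · exact absurd h (B.id_ne t ht t' ht' htt u hut u' hut')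

/-- The UAP `A` has revealed a prefix of the sequence of each multibidder of `B`, and nothing
else. -/
def IsPrefix (A : UAP V) (B : IUAP V) : Prop :=
  A.bidders ⊆ B.bidders ∧ ∀ t ∈ B.multibidders, ∃ i ≤ t.seq.length,
    A.bidders ∩ t.bidders = (t.seq.take i).toFinset

/-- A configuration of the procedure `ToUap` on input `B`. -/
structure Config (B : IUAP V) where
  uap : UAP V
  isPrefix : IsPrefix uap B

/-- The initial configuration: no bidder has been revealed. -/
def Config.init (B : IUAP V) : Config B where
  uap := { bidders := ∅, id_inj := by simp }
  isPrefix := ⟨by simp, fun t _ => ⟨0, by simp, by simp⟩⟩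

/-- The set of ready bidders: the bidders `u` of `B` such that no bidder with the priority of `u` is
matched in a greedy MWM of the current UAP, and `u` is the first bidder that is not yet revealed in
the sequence of its multibidder `t` (lists are indexed from zero). -/
def Config.ready {B : IUAP V} (C : Config B) : Set (Bidder V) :=
  {u | u ∈ B.bidders ∧
    (∀ M, C.uap.IsGreedyMWM M → UAP.priorityCount M u.priority = 0) ∧
    ∃ t ∈ B.multibidders, u ∈ t.seq ∧
      t.seq[(C.uap.bidders ∩ t.bidders).card]? = some u}

/-- Reveal a ready bidder, that is, add it to the current UAP. -/
noncomputable def Config.reveal {B : IUAP V} (C : Config B) (u : Bidder V) (hu : u ∈ C.ready) :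
    Config B where
  uap :=
    { bidders := insert u C.uap.bidders
      id_inj := fun a ha b hb hab =>
        have hs : insert u C.uap.bidders ⊆ B.bidders :=
          Finset.insert_subset hu.1 C.isPrefix.1
        B.eq_of_id_eq (hs ha) (hs hb) hab }
  isPrefix := by
    refine ⟨Finset.insert_subset hu.1 C.isPrefix.1, fun t ht => ?_⟩
    obtain ⟨i, hi, hit⟩ := C.isPrefix.2 t ht
    obtain ⟨-, -, s, hs, hus, hget⟩ := hu
    by_cases hst : s = t
    · subst hst
      have hnd : s.seq.Nodup := List.Nodup.of_map _ s.ids_nodup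
      have hcard : (C.uap.bidders ∩ s.bidders).card = i := by
        rw [hit, List.toFinset_card_of_nodup (hnd.sublist (List.take_sublist _ _)),
          List.length_take, min_eq_left hi]
      rw [hcard] at hget
      obtain ⟨hlt, hu'⟩ := List.getElem?_eq_some_iff.1 hget
      refine ⟨i + 1, hlt, ?_⟩
      have hus' : u ∈ s.bidders := by simpa [Multibidder.bidders] using hus
      rw [Finset.insert_inter_of_mem hus', hit, List.take_add_one, hget]
      ext x
      simp
    · refine ⟨i, hi, ?_⟩
      have hut : u ∉ t.bidders := by
        intro h
        exact B.id_ne s hs t ht hst u hus u (by simpa [Multibidder.bidders] using h) rfl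
      rw [Finset.insert_inter_of_notMem hut, hit]

/-- One iteration of the loop of `ToUap`: an arbitrary ready bidder is revealed. -/
def Config.Step {B : IUAP V} (C C' : Config B) : Prop :=
  ∃ u, ∃ hu : u ∈ C.ready, C' = C.reveal u hu

/-- Some execution of `ToUap` on input `B` returns `A`. -/
def ToUapReturns (B : IUAP V) (A : UAP V) : Prop :=
  ∃ C : Config B, Relation.ReflTransGen Config.Step (Config.init B) C ∧ C.ready = ∅ ∧ C.uap = A

/-- Every execution of `ToUap` on input `B` terminates. -/
def ToUapTerminates (B : IUAP V) : Prop :=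
  ¬ ∃ C : ℕ → Config B, C 0 = Config.init B ∧ ∀ k, (C k).Step (C (k + 1))

end IUAP

/-! ### Stable marriage with incomplete and weak preferences -/

/-- A weak preference relation: `rel a b` means that `a` is at least as good as `b`. -/
structure WeakPref (α : Type*) where
  rel : α → α → Prop
  trans : ∀ a b c, rel a b → rel b c → rel a c
  total : ∀ a b, rel a b ∨ rel b a

/-- The asymmetric part of a preference relation. -/
def WeakPref.strict {α : Type*} (R : WeakPref α) (a b : α) : Prop := R.rel a b ∧ ¬ R.rel b a

/-- The preferences of the men `P` and of the women `Q`; `none` stands for being unmatched. -/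
structure Profile (P Q : Type*) where
  men : P → WeakPref (Option Q)
  women : Q → WeakPref (Option P)

open Classical in
/-- The profile in which the man `p` expresses `R`, and all else is unchanged. -/
noncomputable def Profile.withMan {P Q : Type*} (I : Profile P Q) (p : P)
    (R : WeakPref (Option Q)) : Profile P Q where
  men := Function.update I.men p R
  women := I.women

/-- A matching of men and women. -/
structure Matching (P Q : Type*) where
  man : P → Option Q
  inj : ∀ p p' q, man p = some q → man p' = some q → p = p'

namespace Matching

variable {P Q : Type*}

open Classical in
/-- The partner of a woman. -/
noncomputable def woman (μ : Matching P Q) (q : Q) : Option P :=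
  if h : ∃ p, μ.man p = some q then some h.choose else none

/-- Individual rationality. -/
def IndividuallyRational (I : Profile P Q) (μ : Matching P Q) : Prop :=
  ∀ p q, μ.man p = some q → (I.men p).rel (some q) none ∧ (I.women q).rel (some p) none

/-- `(p, q)` is a strongly blocking pair for `μ`. -/
def StronglyBlocks (I : Profile P Q) (μ : Matching P Q) (p : P) (q : Q) : Prop :=
  (I.men p).strict (some q) (μ.man p) ∧ (I.women q).strict (some p) (μ.woman q)

/-- Weak stability. -/
def WeaklyStable (I : Profile P Q) (μ : Matching P Q) : Prop :=
  μ.IndividuallyRational I ∧ ∀ p q, ¬ μ.StronglyBlocks I p q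

/-- Every agent finds `μ` at least as good as `μ'`. -/
def AtLeastAsGood (I : Profile P Q) (μ μ' : Matching P Q) : Prop :=
  (∀ p, (I.men p).rel (μ.man p) (μ'.man p)) ∧ ∀ q, (I.women q).rel (μ.woman q) (μ'.woman q)

/-- `μ` Pareto-dominates `μ'`. -/
def ParetoDominates (I : Profile P Q) (μ μ' : Matching P Q) : Prop :=
  AtLeastAsGood I μ μ' ∧ ¬ AtLeastAsGood I μ' μ

/-- Pareto-optimality. -/
def ParetoOptimal (I : Profile P Q) (μ : Matching P Q) : Prop :=
  ∀ μ' : Matching P Q, ¬ ParetoDominates I μ' μ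

/-- Pareto-stability. -/
def ParetoStable (I : Profile P Q) (μ : Matching P Q) : Prop :=
  μ.ParetoOptimal I ∧ μ.WeaklyStable I

end Matching

/-- A (nondeterministic) mechanism assigns to each profile the set of its possible outputs. -/
abbrev Mechanism (P Q : Type*) := Profile P Q → Set (Matching P Q)

/-- On every profile the mechanism has an output, and every output is Pareto-stable. -/
def Mechanism.IsParetoStable {P Q : Type*} (F : Mechanism P Q) : Prop :=
  ∀ I, (F I).Nonempty ∧ ∀ μ ∈ F I, μ.ParetoStable I

/-- Strategyproofness for the men, whatever the nondeterministic choices made in the two runs. -/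
def Mechanism.IsStrategyproof {P Q : Type*} (F : Mechanism P Q) : Prop :=
  ∀ (I : Profile P Q) (p : P) (R : WeakPref (Option Q)),
    ∀ μ ∈ F I, ∀ μ' ∈ F (I.withMan p R), (I.men p).rel (μ.man p) (μ'.man p)

/-- A utility assignment: a rule that turns the preferences of the women (and not those of the men)
into a utility function `util W q` for each woman `q`, representing her preferences, with value `0`
at being unmatched. -/
structure UtilityAssignment (P Q : Type*) where
  util : (Q → WeakPref (Option P)) → Q → Option P → ℝ
  util_none : ∀ W q, util W q none = 0
  util_le_iff : ∀ W q a b, (W q).rel a b ↔ util W q b ≤ util W q a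

/-! ### The algorithm -/

section Tiers

variable {α : Type*} [Fintype α]

open Classical in
/-- The indifference class of `a`. -/
noncomputable def WeakPref.tierOf (R : WeakPref α) (a : α) : Finset α :=
  Finset.univ.filter (fun b => R.rel a b ∧ R.rel b a)

open Classical in
/-- The number of tiers. -/
noncomputable def WeakPref.numTiers (R : WeakPref α) : ℕ :=
  (Finset.univ.image R.tierOf).card

open Classical in
/-- The number (from zero) of the tier of `a`: the number of tiers strictly preferred to `a`. -/
noncomputable def WeakPref.tierIndex (R : WeakPref α) (a : α) : ℕ :=
  ((Finset.univ.filter (fun b => R.strict b a)).image R.tierOf).card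

end Tiers

/-- The items: one for each woman, and one dummy item for each man. -/
abbrev Item (m n : ℕ) := Fin n ⊕ Fin m

/-- The item that stands for the alternative `a` of the man `i`: the item of a woman, or his own
dummy item if `a` is to be unmatched. -/
def itemOf {m n : ℕ} (i : Fin m) : Option (Fin n) → Item m n
  | some j => Sum.inl j
  | none => Sum.inr i

open Classical in
/-- The bidder of the man `i` for his tier `k`, when his preferences are `R` and the utilities of
the women are `ψ`. It offers `ψ j i` for the item of each woman `j` in the tier, and `0` for the
dummy item of `i` if being unmatched is in the tier. -/
noncomputable def manBidder {m n : ℕ} (R : WeakPref (Option (Fin n)))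
    (ψ : Fin n → Option (Fin m) → ℝ) (i : Fin m) (k : ℕ) : Bidder (Item m n) where
  id := (Nat.pair i k : ℕ)
  bid := fun v => match v with
    | Sum.inl j => if R.tierIndex (some j) = k then some (ψ j (some i)) else none
    | Sum.inr i' => if i' = i ∧ R.tierIndex none = k then some 0 else none
  priority := (i : ℝ) + 1

/-- The multibidder of the man `i`: one bidder for each tier, best tier first. -/
noncomputable def manMultibidder {m n : ℕ} (R : WeakPref (Option (Fin n)))
    (ψ : Fin n → Option (Fin m) → ℝ) (i : Fin m) : Multibidder (Item m n) where
  seq := (List.range R.numTiers).map (manBidder R ψ i)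
  priority := (i : ℝ) + 1
  priority_eq := by
    intro u hu
    obtain ⟨k, -, rfl⟩ := List.mem_map.1 hu
    rfl
  ids_nodup := by
    rw [List.map_map]
    refine List.Nodup.map (fun k k' h => ?_) List.nodup_range
    have h' : Nat.pair (i : ℕ) k = Nat.pair (i : ℕ) k' :=
      Nat.cast_injective (R := ℤ) h
    exact (Nat.pair_eq_pair.1 h').2

/-- The IUAP built from a profile and from the utilities of the women. -/
noncomputable def smiwIUAP {m n : ℕ} (Ψ : UtilityAssignment (Fin m) (Fin n))
    (I : Profile (Fin m) (Fin n)) : IUAP (Item m n) where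
  multibidders := Finset.univ.image fun i => manMultibidder (I.men i) (Ψ.util I.women) i
  priority_ne := by
    intro t ht t' ht' hne h
    obtain ⟨i, -, rfl⟩ := Finset.mem_image.1 ht
    obtain ⟨i', -, rfl⟩ := Finset.mem_image.1 ht'
    have h' : (i : ℝ) + 1 = (i' : ℝ) + 1 := h
    have hii : i = i' := Fin.ext (by exact_mod_cast add_right_cancel h')
    exact hne (by rw [hii])
  id_ne := by
    intro t ht t' ht' hne u hu u' hu' h
    obtain ⟨i, -, rfl⟩ := Finset.mem_image.1 ht
    obtain ⟨i', -, rfl⟩ := Finset.mem_image.1 ht'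
    obtain ⟨k, -, rfl⟩ := List.mem_map.1 hu
    obtain ⟨k', -, rfl⟩ := List.mem_map.1 hu'
    have h' : Nat.pair (i : ℕ) k = Nat.pair (i' : ℕ) k' :=
      Nat.cast_injective (R := ℤ) h
    have hii : i = i' := Fin.ext (Nat.pair_eq_pair.1 h').1
    exact hne (by rw [hii])

/-- `μ` is the matching read off from the matching `M₀` of bidders and items: the man `i` gets the
alternative `a` if and only if one of his bidders is matched in `M₀` to the item of `a`. -/
def ReadOff {m n : ℕ} (Ψ : UtilityAssignment (Fin m) (Fin n)) (I : Profile (Fin m) (Fin n))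
    (M₀ : Finset (Bidder (Item m n) × Item m n)) (μ : Matching (Fin m) (Fin n)) : Prop :=
  ∀ i a, μ.man i = a ↔
    ∃ u ∈ (manMultibidder (I.men i) (Ψ.util I.women) i).seq, (u, itemOf i a) ∈ M₀

/-- The algorithm, as a nondeterministic mechanism: run `ToUap` on the IUAP of the profile, take any
greedy MWM of the UAP that it returns, and read off the matching. -/
def smiwMechanism {m n : ℕ} (Ψ : UtilityAssignment (Fin m) (Fin n)) :
    Mechanism (Fin m) (Fin n) :=
  fun I => {μ | ∃ A, (smiwIUAP Ψ I).ToUapReturns A ∧ ∃ M₀, A.IsGreedyMWM M₀ ∧ ReadOff Ψ I M₀ μ}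

/-- On the profile `I`, every run of the algorithm terminates and returns exactly one matching,
whatever its nondeterministic choices. -/
def AlwaysReturns {m n : ℕ} (Ψ : UtilityAssignment (Fin m) (Fin n))
    (I : Profile (Fin m) (Fin n)) : Prop :=
  (smiwIUAP Ψ I).ToUapTerminates ∧
    ∀ A, (smiwIUAP Ψ I).ToUapReturns A →
      (∃ M₀, A.IsGreedyMWM M₀) ∧ ∀ M₀, A.IsGreedyMWM M₀ → ∃! μ, ReadOff Ψ I M₀ μ

end SMIW

namespace SMIW

namespace UAP

variable {V : Type*}

/-! ### Exchanging matchings along an alternating path -/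

/-! All priorities of the men's bidders are positive, so a greedy MWM is the same as a matching that
maximizes (weight, total priority) lexicographically (`isGreedyMWM_iff`). This objective is additive
over edges, so two matchings can be swapped along an alternating path without changing the sum of
their values (`exists_exchange`).

Call a bidder dead if no optimal matching matches it. Dead bidders stay dead as the auction grows
(`Alive.anti`), so only the last revealed bidder of a man can be matched. All optimal matchings
match the same priorities (`IsOpt.exists_priority_eq`), and the dummy item keeps the bidder for the
tier of ∅ matched once it is revealed. Hence, at termination, every optimal matching matches every
man through his last revealed bidder, and the output is well defined.

The weight of the edges read off is the sum of the women's utilities. A Pareto improvement would use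
revealed bidders only and match every man, so it would itself be optimal; then no woman gains, and
every man stays in his last revealed tier. A blocking pair would allow an edge change that raises
the weight.

For strategyproofness, suppose that a misreport gives `p` something better than his tier `k`. Stop
the truthful run when he is about to reveal tier `k`: all his revealed bidders are dead. In the
outcome of the misreport, replace his bidder by the truthful one, which has the same weight and
priority. The alternating path from it must end at a bidder, revealed in the stopped run only, of
another man; otherwise the swap would lower one optimum without raising the other. The last bidder
of any such man in the misreport run is dead in the stopped run, and starts a path of the same kind.
There is one more start than there are men at whom paths can end, yet a path is determined by its
end (`AltReach.source_unique`). -/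

theorem mem_matched {M : Finset (Bidder V × V)} {u : Bidder V} :
    u ∈ matched M ↔ ∃ v, (u, v) ∈ M := by
  simp [matched]

theorem matched_mono {M N : Finset (Bidder V × V)} (h : M ⊆ N) : matched M ⊆ matched N :=
  Finset.image_subset_image h

/-- A set of edges no two of which share an endpoint. -/
structure IsEdgeMatching (M : Finset (Bidder V × V)) : Prop where
  item_eq : ∀ u v v', (u, v) ∈ M → (u, v') ∈ M → v = v'
  bidder_eq : ∀ u u' v, (u, v) ∈ M → (u', v) ∈ M → u = u'

theorem IsEdgeMatching.erase {M : Finset (Bidder V × V)} [DecidableEq (Bidder V × V)]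
    (h : IsEdgeMatching M) (e : Bidder V × V) : IsEdgeMatching (M.erase e) :=
  ⟨fun _ _ _ h₁ h₂ => h.item_eq _ _ _ (Finset.mem_of_mem_erase h₁) (Finset.mem_of_mem_erase h₂),
    fun _ _ _ h₁ h₂ => h.bidder_eq _ _ _ (Finset.mem_of_mem_erase h₁) (Finset.mem_of_mem_erase h₂)⟩

theorem IsEdgeMatching.insert {M : Finset (Bidder V × V)} [DecidableEq (Bidder V × V)]
    (hM : IsEdgeMatching M) {u : Bidder V} {v : V} (hu : u ∉ matched M)
    (hv : ∀ u', (u', v) ∉ M) : IsEdgeMatching (Insert.insert (u, v) M) := by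
  constructor
  · intro x y y' h h'
    rw [Finset.mem_insert, Prod.mk.injEq] at h h'
    rcases h with ⟨rfl, rfl⟩ | h <;> rcases h' with ⟨hx, rfl⟩ | h'
    · rfl
    · exact absurd (mem_matched.2 ⟨_, h'⟩) hu
    · subst hx
      exact absurd (mem_matched.2 ⟨_, h⟩) hu
    · exact hM.item_eq _ _ _ h h'
  · intro x x' y h h'
    rw [Finset.mem_insert, Prod.mk.injEq] at h h'
    rcases h with ⟨rfl, rfl⟩ | h <;> rcases h' with ⟨rfl, hx⟩ | h'
    · rfl
    · exact absurd h' (hv _)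
    · subst hx
      exact absurd h (hv _)
    · exact hM.bidder_eq _ _ _ h h'

/-- In a matching, the item of an edge can be given to an unmatched bidder. -/
theorem IsEdgeMatching.replace {M : Finset (Bidder V × V)} [DecidableEq (Bidder V × V)]
    (hM : IsEdgeMatching M) {u u' : Bidder V} {v : V} (h : (u', v) ∈ M)
    (hu : u ∉ matched (M.erase (u', v))) : IsEdgeMatching (Insert.insert (u, v) (M.erase (u', v))) := by
  refine (hM.erase _).insert hu fun x hx => ?_
  obtain ⟨hne, hx⟩ := Finset.mem_erase.1 hx
  exact hne (by rw [hM.bidder_eq _ _ _ hx h])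

theorem isMatching_iff {A : UAP V} {M : Finset (Bidder V × V)} :
    A.IsMatching M ↔
      IsEdgeMatching M ∧ ∀ u v, (u, v) ∈ M → u ∈ A.bidders ∧ (u.bid v).isSome := by
  constructor
  · intro h
    refine ⟨⟨fun u v v' h₁ h₂ => ?_, fun u u' v h₁ h₂ => ?_⟩, fun u v h' => h.edge _ h'⟩
    · exact congrArg Prod.snd (h.bidder_inj _ h₁ _ h₂ rfl)
    · exact congrArg Prod.fst (h.item_inj _ h₁ _ h₂ rfl)
  · rintro ⟨h, h'⟩
    refine ⟨fun e he => h' _ _ he, ?_, ?_⟩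
    · rintro ⟨u, v⟩ h₁ ⟨u', v'⟩ h₂ (rfl : u = u')
      rw [h.item_eq _ _ _ h₁ h₂]
    · rintro ⟨u, v⟩ h₁ ⟨u', v'⟩ h₂ (rfl : v = v')
      rw [h.bidder_eq _ _ _ h₁ h₂]

/-- Two steps of a path that alternates between edges of `M₂` and of `M₁`: from a bidder to the item
matched to it in `M₂`, then to the bidder matched to this item in `M₁`. -/
def AltStep (M₁ M₂ : Finset (Bidder V × V)) (x y : Bidder V) : Prop :=
  ∃ v, (x, v) ∈ M₂ ∧ (y, v) ∈ M₁

/-- Reachability along alternating paths. -/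
def AltReach (M₁ M₂ : Finset (Bidder V × V)) : Bidder V → Bidder V → Prop :=
  Relation.ReflTransGen (AltStep M₁ M₂)

theorem AltReach.eq_or_mem_matched {M₁ M₂ : Finset (Bidder V × V)} {x y : Bidder V}
    (h : AltReach M₁ M₂ x y) : y = x ∨ y ∈ matched M₁ := by
  rcases Relation.ReflTransGen.cases_tail h with h | ⟨z, -, v, -, hv⟩
  · exact Or.inl h
  · exact Or.inr (mem_matched.2 ⟨v, hv⟩)

/-- An alternating path is determined by its last bidder, if its first one is unmatched in `M₁`. -/
theorem AltReach.source_unique {M₁ M₂ : Finset (Bidder V × V)} (h₁ : IsEdgeMatching M₁)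
    (h₂ : IsEdgeMatching M₂) {x x' y : Bidder V} (hx : x ∉ matched M₁) (hx' : x' ∉ matched M₁)
    (h : AltReach M₁ M₂ x y) (h' : AltReach M₁ M₂ x' y) : x = x' := by
  -- Backward steps are deterministic, so one of the two sources reaches the other; a bidder
  -- unmatched in `M₁` has no predecessor.
  have hU : Relator.RightUnique (Function.swap (AltStep M₁ M₂)) := by
    rintro a b c ⟨v, hb, ha⟩ ⟨v', hc, ha'⟩
    obtain rfl := h₁.item_eq _ _ _ ha ha'
    exact h₂.bidder_eq _ _ _ hb hc
  rcases Relation.ReflTransGen.total_of_right_unique hU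
    (Relation.ReflTransGen.swap _ _ h) (Relation.ReflTransGen.swap _ _ h') with h | h
  · exact (AltReach.eq_or_mem_matched (Relation.ReflTransGen.swap _ _ h)).resolve_right hx
  · exact ((AltReach.eq_or_mem_matched (Relation.ReflTransGen.swap _ _ h)).resolve_right hx').symm

/-- An alternating path is determined by its first bidder, if its last one is unmatched in `M₂`. -/
theorem AltReach.target_unique {M₁ M₂ : Finset (Bidder V × V)} (h₁ : IsEdgeMatching M₁)
    (h₂ : IsEdgeMatching M₂) {x y y' : Bidder V} (hy : y ∉ matched M₂) (hy' : y' ∉ matched M₂)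
    (h : AltReach M₁ M₂ x y) (h' : AltReach M₁ M₂ x y') : y = y' := by
  have hU : Relator.RightUnique (AltStep M₁ M₂) := by
    rintro a b c ⟨v, hb, ha⟩ ⟨v', hc, ha'⟩
    obtain rfl := h₂.item_eq _ _ _ hb hc
    exact h₁.bidder_eq _ _ _ ha ha'
  have key : ∀ z z', z ∉ matched M₂ → AltReach M₁ M₂ z z' → z = z' := by
    intro z z' hz hzz
    rcases Relation.ReflTransGen.cases_head hzz with h | ⟨_, ⟨v, hv, -⟩, -⟩
    · exact h
    · exact absurd (mem_matched.2 ⟨v, hv⟩) hz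
  rcases Relation.ReflTransGen.total_of_right_unique hU h h' with h | h
  · exact key _ _ hy h
  · exact (key _ _ hy' h).symm

/-- Exchange of two matchings along the alternating path that starts at a bidder `b` which is
matched in `M₂` but not in `M₁`. The path ends at an item, or at a bidder `c` which is matched in
`M₁` but not in `M₂`. -/
theorem exists_exchange {M₁ M₂ : Finset (Bidder V × V)} (h₁ : IsEdgeMatching M₁)
    (h₂ : IsEdgeMatching M₂) {b : Bidder V} (hb₁ : b ∉ matched M₁) (hb₂ : b ∈ matched M₂)
    {Γ : Type*} [AddCommMonoid Γ] (f : Bidder V × V → Γ) :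
    ∃ N₁ N₂ : Finset (Bidder V × V), IsEdgeMatching N₁ ∧ IsEdgeMatching N₂ ∧
      (∀ e ∈ N₁, e ∈ M₁ ∨ e ∈ M₂) ∧ (∀ e ∈ N₂, e ∈ M₁ ∨ e ∈ M₂) ∧
      ∑ e ∈ N₁, f e + ∑ e ∈ N₂, f e = ∑ e ∈ M₁, f e + ∑ e ∈ M₂, f e ∧
      ((matched N₁ = insert b (matched M₁) ∧ matched N₂ = (matched M₂).erase b) ∨
        ∃ c ∈ matched M₁, c ∉ matched M₂ ∧ AltReach M₁ M₂ b c ∧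
          matched N₁ = insert b ((matched M₁).erase c) ∧
          matched N₂ = insert c ((matched M₂).erase b)) := by
  classical
  let R : Bidder V → Prop := AltReach M₁ M₂ b
  have hRb : R b := Relation.ReflTransGen.refl
  have hR₁ : ∀ x, R x → x ≠ b → x ∈ matched M₁ := fun x hx hxb =>
    hx.eq_or_mem_matched.resolve_left hxb
  have hfwd : ∀ x y v, R x → (x, v) ∈ M₂ → (y, v) ∈ M₁ → R y := fun x y v hx hxv hyv =>
    Relation.ReflTransGen.tail hx ⟨v, hxv, hyv⟩
  -- As `b` is unmatched in `M₁`, the reached set is also closed backwards. No item is then shared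
  -- between a reached and an unreached bidder, which keeps `N₁` and `N₂` matchings.
  have hbwd : ∀ x y v, R y → (y, v) ∈ M₁ → (x, v) ∈ M₂ → R x := by
    intro x y v hy hyv hxv
    rcases Relation.ReflTransGen.cases_tail hy with h | ⟨z, hz, v', hzv, hyv'⟩
    · exact absurd (mem_matched.2 ⟨v, h ▸ hyv⟩) hb₁
    · obtain rfl := h₁.item_eq _ _ _ hyv hyv'
      rwa [h₂.bidder_eq _ _ _ hxv hzv]
  let N₁ := M₁.filter (fun e => ¬ R e.1) ∪ M₂.filter (fun e => R e.1)
  let N₂ := M₂.filter (fun e => ¬ R e.1) ∪ M₁.filter (fun e => R e.1)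
  have mem₁ : ∀ x v, (x, v) ∈ N₁ ↔ ((x, v) ∈ M₁ ∧ ¬ R x) ∨ ((x, v) ∈ M₂ ∧ R x) := by
    intro x v; simp [N₁]
  have mem₂ : ∀ x v, (x, v) ∈ N₂ ↔ ((x, v) ∈ M₂ ∧ ¬ R x) ∨ ((x, v) ∈ M₁ ∧ R x) := by
    intro x v; simp [N₂]
  have mat₁ : ∀ x, x ∈ matched N₁ ↔ (x ∈ matched M₁ ∧ ¬ R x) ∨ (x ∈ matched M₂ ∧ R x) := by
    intro x
    simp only [mem_matched, mem₁, exists_or, exists_and_right]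
  have mat₂ : ∀ x, x ∈ matched N₂ ↔ (x ∈ matched M₂ ∧ ¬ R x) ∨ (x ∈ matched M₁ ∧ R x) := by
    intro x
    simp only [mem_matched, mem₂, exists_or, exists_and_right]
  refine ⟨N₁, N₂, ⟨?_, ?_⟩, ⟨?_, ?_⟩, ?_, ?_, ?_, ?_⟩
  · intro u v v' h h'
    rw [mem₁] at h h'
    rcases h with ⟨h, hu⟩ | ⟨h, hu⟩ <;> rcases h' with ⟨h', hu'⟩ | ⟨h', hu'⟩
    · exact h₁.item_eq _ _ _ h h'
    · exact absurd hu' hu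
    · exact absurd hu hu'
    · exact h₂.item_eq _ _ _ h h'
  · intro u u' v h h'
    rw [mem₁] at h h'
    rcases h with ⟨h, hu⟩ | ⟨h, hu⟩ <;> rcases h' with ⟨h', hu'⟩ | ⟨h', hu'⟩
    · exact h₁.bidder_eq _ _ _ h h'
    · exact absurd (hfwd _ _ _ hu' h' h) hu
    · exact absurd (hfwd _ _ _ hu h h') hu'
    · exact h₂.bidder_eq _ _ _ h h'
  · intro u v v' h h'
    rw [mem₂] at h h'
    rcases h with ⟨h, hu⟩ | ⟨h, hu⟩ <;> rcases h' with ⟨h', hu'⟩ | ⟨h', hu'⟩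
    · exact h₂.item_eq _ _ _ h h'
    · exact absurd hu' hu
    · exact absurd hu hu'
    · exact h₁.item_eq _ _ _ h h'
  · intro u u' v h h'
    rw [mem₂] at h h'
    rcases h with ⟨h, hu⟩ | ⟨h, hu⟩ <;> rcases h' with ⟨h', hu'⟩ | ⟨h', hu'⟩
    · exact h₂.bidder_eq _ _ _ h h'
    · exact absurd (hbwd _ _ _ hu' h' h) hu
    · exact absurd (hbwd _ _ _ hu h h') hu'
    · exact h₁.bidder_eq _ _ _ h h'
  · rintro ⟨x, v⟩ h
    rw [mem₁] at h
    tauto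
  · rintro ⟨x, v⟩ h
    rw [mem₂] at h
    tauto
  · have hd : ∀ M N : Finset (Bidder V × V),
        Disjoint (M.filter (fun e => ¬ R e.1)) (N.filter (fun e => R e.1)) := by
      intro M N
      rw [Finset.disjoint_left]
      intro e he he'
      exact (Finset.mem_filter.1 he).2 (Finset.mem_filter.1 he').2
    rw [Finset.sum_union (hd _ _), Finset.sum_union (hd _ _),
      ← Finset.sum_filter_add_sum_filter_not M₁ (fun e => R e.1),
      ← Finset.sum_filter_add_sum_filter_not M₂ (fun e => R e.1)]
    abel
  -- A reached bidder unmatched in `M₂` is the end of the path, and there is at most one.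
  · by_cases hall : ∀ x, R x → x ∈ matched M₂
    · left
      constructor
      · ext x
        rw [mat₁, Finset.mem_insert]
        grind
      · ext x
        rw [mat₂, Finset.mem_erase]
        grind
    · right
      push Not at hall
      obtain ⟨c, hc, hc₂⟩ := hall
      have hcb : c ≠ b := fun h => hc₂ (h ▸ hb₂)
      have huniq : ∀ x, R x → x ∉ matched M₂ → x = c := fun x hx hx₂ =>
        AltReach.target_unique h₁ h₂ hx₂ hc₂ hx hc
      refine ⟨c, hR₁ c hc hcb, hc₂, hc, ?_, ?_⟩
      · ext x
        rw [mat₁, Finset.mem_insert, Finset.mem_erase]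
        grind
      · ext x
        rw [mat₂, Finset.mem_insert, Finset.mem_erase]
        grind

/-! ### Greedy maximum-weight matchings as lexicographically optimal matchings -/

/-- The weight of an edge, refined by the priority of its bidder. -/
noncomputable def lexEdge (e : Bidder V × V) : ℝ ×ₗ ℝ := toLex (e.1.weight e.2, e.1.priority)

/-- The total weight of a set of edges, refined by the total priority of the matched bidders. -/
noncomputable def lexWeight (M : Finset (Bidder V × V)) : ℝ ×ₗ ℝ := ∑ e ∈ M, lexEdge e

/-- A matching uses each bidder at most once, so summing priorities over edges is summing them over
matched bidders. -/
theorem lexWeight_eq {M : Finset (Bidder V × V)} (h : IsEdgeMatching M) :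
    lexWeight M = toLex (weight M, setPriority (matched M)) := by
  have h' : setPriority (matched M) = ∑ e ∈ M, e.1.priority := by
    rw [setPriority, matched, Finset.sum_image]
    rintro ⟨u, v⟩ he ⟨u', v'⟩ he' (rfl : u = u')
    rw [h.item_eq _ _ _ he he']
  have key : ∀ s : Finset (Bidder V × V), ∑ e ∈ s, lexEdge e =
      toLex (∑ e ∈ s, e.1.weight e.2, ∑ e ∈ s, e.1.priority) := by
    classical
    intro s
    induction s using Finset.induction_on with
    | empty => rfl
    | insert e s he ih =>
      rw [Finset.sum_insert he, Finset.sum_insert he, Finset.sum_insert he, ih]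
      rfl
  rw [h', weight, lexWeight, key]

/-- A matching of maximum lexicographic weight. -/
def IsOpt (A : UAP V) (M : Finset (Bidder V × V)) : Prop :=
  A.IsMatching M ∧ ∀ M', A.IsMatching M' → lexWeight M' ≤ lexWeight M

theorem IsMatching.isEdgeMatching {A : UAP V} {M : Finset (Bidder V × V)} (h : A.IsMatching M) :
    IsEdgeMatching M :=
  (isMatching_iff.1 h).1

theorem IsMatching.matched_subset {A : UAP V} {M : Finset (Bidder V × V)} (h : A.IsMatching M) :
    matched M ⊆ A.bidders := by
  intro u hu
  obtain ⟨v, hv⟩ := mem_matched.1 hu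
  exact (h.edge _ hv).1

theorem exists_isOpt [Fintype V] (A : UAP V) : ∃ M, A.IsOpt M := by
  classical
  let s := (A.bidders ×ˢ (Finset.univ : Finset V)).powerset.filter A.IsMatching
  have hs : ∀ M, M ∈ s ↔ A.IsMatching M := by
    intro M
    simp only [s, Finset.mem_filter, Finset.mem_powerset, and_iff_right_iff_imp]
    intro h e he
    simp [(h.edge e he).1]
  have hne : s.Nonempty := ⟨∅, (hs ∅).2 ⟨by simp, by simp, by simp⟩⟩
  obtain ⟨M, hM, hmax⟩ := s.exists_max_image lexWeight hne
  exact ⟨M, (hs M).1 hM, fun M' hM' => hmax M' ((hs M').2 hM')⟩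

theorem IsOpt.isMWM {A : UAP V} {M : Finset (Bidder V × V)} (h : A.IsOpt M) : A.IsMWM M := by
  refine ⟨h.1, fun M' hM' => ?_⟩
  have := h.2 M' hM'
  rw [lexWeight_eq hM'.isEdgeMatching, lexWeight_eq h.1.isEdgeMatching,
    Prod.Lex.toLex_le_toLex] at this
  rcases this with h | h
  · exact h.le
  · exact h.1.le

theorem IsOpt.setPriority_le {A : UAP V} {M M' : Finset (Bidder V × V)} (h : A.IsOpt M)
    (h' : A.IsMWM M') : setPriority (matched M') ≤ setPriority (matched M) := by
  have := h.2 M' h'.1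
  rw [lexWeight_eq h'.1.isEdgeMatching, lexWeight_eq h.1.isEdgeMatching,
    Prod.Lex.toLex_le_toLex] at this
  rcases this with h'' | h''
  · exact absurd (h'.2 M h.1) (not_le.2 h'')
  · exact h''.2

theorem setPriority_mono {A : UAP V} (hA : ∀ u ∈ A.bidders, 0 < u.priority)
    {S T : Finset (Bidder V)} (hST : S ⊆ T) (hT : T ⊆ A.bidders) :
    setPriority S ≤ setPriority T :=
  Finset.sum_le_sum_of_subset_of_nonneg hST fun u hu _ => (hA u (hT hu)).le

theorem setPriority_strictMono {A : UAP V} (hA : ∀ u ∈ A.bidders, 0 < u.priority)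
    {S T : Finset (Bidder V)} (hST : S ⊂ T) (hT : T ⊆ A.bidders) :
    setPriority S < setPriority T := by
  obtain ⟨u, hu, huS⟩ := Finset.exists_of_ssubset hST
  exact Finset.sum_lt_sum_of_subset hST.1 hu huS (hA u (hT hu))
    fun u hu _ => (hA u (hT hu)).le

/-- For positive priorities, the greedy MWMs are the matchings of maximum lexicographic weight. -/
theorem isGreedyMWM_iff {A : UAP V} (hA : ∀ u ∈ A.bidders, 0 < u.priority)
    {M : Finset (Bidder V × V)} : A.IsGreedyMWM M ↔ A.IsOpt M := by
  constructor
  · rintro ⟨hM, -, hpr⟩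
    refine ⟨hM.1, fun M' hM' => ?_⟩
    rw [lexWeight_eq hM'.isEdgeMatching, lexWeight_eq hM.1.isEdgeMatching,
      Prod.Lex.toLex_le_toLex]
    rcases (hM.2 M' hM').lt_or_eq with h | h
    · exact Or.inl h
    · refine Or.inr ⟨h, ?_⟩
      have hM'' : A.IsMWM M' := ⟨hM', fun N hN => (hM.2 N hN).trans h.ge⟩
      -- Greediness compares maximal independent sets only, so `matched M'` is extended to one; by
      -- positivity this loses no priority.
      have hfin : {S | A.Indep S}.Finite :=
        (A.bidders.powerset.finite_toSet).subset fun S hS => by simpa using hS.1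
      obtain ⟨S, hS, hmax⟩ := hfin.exists_le_maximal
        (show A.Indep (matched M') from ⟨hM'.matched_subset, M', hM'', subset_rfl⟩)
      exact (setPriority_mono hA hS hmax.prop.1).trans (hpr S hmax)
  · intro hM
    have hle : ∀ S, A.Indep S → setPriority S ≤ setPriority (matched M) := by
      rintro S ⟨-, M', hM', hS⟩
      exact (setPriority_mono hA hS hM'.1.matched_subset).trans (hM.setPriority_le hM')
    refine ⟨hM.isMWM, ⟨⟨hM.1.matched_subset, M, hM.isMWM, subset_rfl⟩, ?_⟩,
      fun S hS => hle S hS.prop⟩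
    intro S hS hMS
    by_contra hSM
    exact absurd (hle S hS) (not_le.2 (setPriority_strictMono hA ⟨hMS, hSM⟩ hS.1))

/-! ### Bidders matched in an optimal matching -/

/-- Some optimal matching matches `u`. -/
def Alive (A : UAP V) (u : Bidder V) : Prop := ∃ M, A.IsOpt M ∧ u ∈ matched M

/-- Whether an edge carries a bid depends on the edge alone, so after an exchange, even between
different auctions, only membership of the matched bidders has to be rechecked. -/
theorem isMatching_of_matched_subset {A A₁ A₂ : UAP V} {M₁ M₂ N : Finset (Bidder V × V)}
    (h₁ : A₁.IsMatching M₁) (h₂ : A₂.IsMatching M₂) (hN : IsEdgeMatching N)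
    (hsub : ∀ e ∈ N, e ∈ M₁ ∨ e ∈ M₂) (hA : matched N ⊆ A.bidders) : A.IsMatching N := by
  refine isMatching_iff.2 ⟨hN, fun u v huv => ⟨hA (mem_matched.2 ⟨v, huv⟩), ?_⟩⟩
  rcases hsub _ huv with h | h
  · exact (h₁.edge _ h).2
  · exact (h₂.edge _ h).2

/-- A bidder that is matched in no optimal matching remains so when more bidders are added. -/
theorem Alive.anti [Fintype V] {A A' : UAP V} (hA : A.bidders ⊆ A'.bidders) {u : Bidder V}
    (hu : u ∈ A.bidders) (h : A'.Alive u) : A.Alive u := by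
  obtain ⟨M₂, hM₂, hu₂⟩ := h
  obtain ⟨M₁, hM₁⟩ := A.exists_isOpt
  by_cases hu₁ : u ∈ matched M₁
  · exact ⟨M₁, hM₁, hu₁⟩
  obtain ⟨N₁, N₂, hN₁, hN₂, hs₁, hs₂, hw, hcase⟩ :=
    exists_exchange hM₁.1.isEdgeMatching hM₂.1.isEdgeMatching hu₁ hu₂ lexEdge
  have hsub₁ := hM₁.1.matched_subset
  have hsub₂ := hM₂.1.matched_subset
  have key : u ∈ matched N₁ ∧ matched N₁ ⊆ A.bidders ∧ matched N₂ ⊆ A'.bidders := by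
    rcases hcase with ⟨h₁, h₂⟩ | ⟨c, hc, -, -, h₁, h₂⟩
    · rw [h₁, h₂]
      exact ⟨Finset.mem_insert_self _ _, Finset.insert_subset hu hsub₁,
        (Finset.erase_subset _ _).trans hsub₂⟩
    · rw [h₁, h₂]
      exact ⟨Finset.mem_insert_self _ _,
        Finset.insert_subset hu ((Finset.erase_subset _ _).trans hsub₁),
        Finset.insert_subset (hA (hsub₁ hc)) ((Finset.erase_subset _ _).trans hsub₂)⟩
  have hmN₁ : A.IsMatching N₁ := isMatching_of_matched_subset hM₁.1 hM₂.1 hN₁ hs₁ key.2.1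
  have hmN₂ : A'.IsMatching N₂ := isMatching_of_matched_subset hM₁.1 hM₂.1 hN₂ hs₂ key.2.2
  refine ⟨N₁, ⟨hmN₁, fun M' hM' => (hM₁.2 M' hM').trans ?_⟩, key.1⟩
  -- `N₂` does not beat `M₂` and the sum is preserved, so `N₁` is at least as good as `M₁`.
  have h₂ := hM₂.2 N₂ hmN₂
  by_contra hlt
  have := add_lt_add_of_lt_of_le (not_le.1 hlt) h₂
  exact absurd hw this.ne

/-- Optimal matchings match bidders of the same priorities. -/
theorem IsOpt.exists_priority_eq {A : UAP V} (hA : ∀ u ∈ A.bidders, 0 < u.priority)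
    {M₁ M₂ : Finset (Bidder V × V)} (hM₁ : A.IsOpt M₁) (hM₂ : A.IsOpt M₂) {u : Bidder V}
    (hu₂ : u ∈ matched M₂) : ∃ c ∈ matched M₁, c.priority = u.priority := by
  by_cases hu₁ : u ∈ matched M₁
  · exact ⟨u, hu₁, rfl⟩
  obtain ⟨N₁, N₂, hN₁, hN₂, hs₁, hs₂, hw, hcase⟩ :=
    exists_exchange hM₁.1.isEdgeMatching hM₂.1.isEdgeMatching hu₁ hu₂ lexEdge
  have hsub₁ := hM₁.1.matched_subset
  have hsub₂ := hM₂.1.matched_subset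
  have key : matched N₁ ⊆ A.bidders ∧ matched N₂ ⊆ A.bidders := by
    rcases hcase with ⟨h₁, h₂⟩ | ⟨c, hc, -, -, h₁, h₂⟩
    · rw [h₁, h₂]
      exact ⟨Finset.insert_subset (hsub₂ hu₂) hsub₁, (Finset.erase_subset _ _).trans hsub₂⟩
    · rw [h₁, h₂]
      exact ⟨Finset.insert_subset (hsub₂ hu₂) ((Finset.erase_subset _ _).trans hsub₁),
        Finset.insert_subset (hsub₁ hc) ((Finset.erase_subset _ _).trans hsub₂)⟩
  have hmN₁ : A.IsMatching N₁ := isMatching_of_matched_subset hM₁.1 hM₂.1 hN₁ hs₁ key.1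
  have hmN₂ : A.IsMatching N₂ := isMatching_of_matched_subset hM₁.1 hM₂.1 hN₂ hs₂ key.2
  have hle₁ := hM₁.2 N₁ hmN₁
  have hle₂ := hM₂.2 N₂ hmN₂
  have heq : lexWeight N₁ = lexWeight M₁ := by
    refine hle₁.antisymm ?_
    by_contra hlt
    have := add_lt_add_of_lt_of_le (not_le.1 hlt) hle₂
    exact absurd hw this.ne
  rw [lexWeight_eq hN₁, lexWeight_eq hM₁.1.isEdgeMatching] at heq
  have hpr : setPriority (matched N₁) = setPriority (matched M₁) :=
    congrArg (fun x => (ofLex x).2) heq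
  -- Adding `u` alone would raise the total priority, and trading `c` for `u` preserves it only if
  -- their priorities agree.
  rcases hcase with ⟨h₁, -⟩ | ⟨c, hc, -, -, h₁, -⟩
  · rw [h₁, setPriority, Finset.sum_insert hu₁] at hpr
    have := hA u (hsub₂ hu₂)
    simp only [setPriority] at hpr
    linarith
  · refine ⟨c, hc, ?_⟩
    have hu' : u ∉ (matched M₁).erase c := fun h => hu₁ (Finset.mem_of_mem_erase h)
    rw [h₁, setPriority, Finset.sum_insert hu'] at hpr
    have := Finset.add_sum_erase (matched M₁) Bidder.priority hc
    simp only [setPriority] at hpr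
    linarith

end UAP

/-! ### Tiers -/

section Tiers

variable {α : Type*} (R : WeakPref α)

theorem WeakPref.refl (a : α) : R.rel a a := (R.total a a).elim id id

theorem WeakPref.strict_iff {a b : α} : R.strict a b ↔ ¬ R.rel b a :=
  ⟨fun h => h.2, fun h => ⟨(R.total a b).resolve_right h, h⟩⟩

variable [Fintype α]

theorem WeakPref.tierIndex_le {a b : α} (h : R.rel a b) : R.tierIndex a ≤ R.tierIndex b := by
  classical
  refine Finset.card_le_card (Finset.image_subset_image fun c hc => ?_)
  rw [Finset.mem_filter] at hc ⊢
  refine ⟨hc.1, ?_⟩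
  have := hc.2
  rw [WeakPref.strict_iff] at this ⊢
  exact fun h' => this (R.trans _ _ _ h h')

theorem WeakPref.tierIndex_lt {a b : α} (h : R.strict a b) : R.tierIndex a < R.tierIndex b := by
  classical
  refine Finset.card_lt_card ⟨Finset.image_subset_image fun c hc => ?_, fun hsub => ?_⟩
  · rw [Finset.mem_filter] at hc ⊢
    refine ⟨hc.1, ?_⟩
    have := hc.2
    rw [WeakPref.strict_iff] at this ⊢
    exact fun h' => this (R.trans _ _ _ h.1 h')
  -- The tier of `a` is counted for `b`. Were it counted for `a`, it would contain something
  -- strictly better than `a`.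
  · have ha := hsub (Finset.mem_image_of_mem R.tierOf
      (Finset.mem_filter.2 ⟨Finset.mem_univ a, h⟩))
    obtain ⟨c, hc, hca⟩ := Finset.mem_image.1 ha
    have hac : a ∈ R.tierOf a := Finset.mem_filter.2 ⟨Finset.mem_univ a, R.refl a, R.refl a⟩
    rw [← hca] at hac
    exact (Finset.mem_filter.1 hc).2.2 (Finset.mem_filter.1 hac).2.2

theorem WeakPref.tierIndex_le_iff {a b : α} : R.tierIndex a ≤ R.tierIndex b ↔ R.rel a b := by
  refine ⟨fun h => ?_, R.tierIndex_le⟩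
  by_contra hab
  exact absurd (R.tierIndex_lt (R.strict_iff.2 hab)) (not_lt.2 h)

theorem WeakPref.tierIndex_lt_iff {a b : α} : R.tierIndex a < R.tierIndex b ↔ R.strict a b := by
  rw [WeakPref.strict_iff, ← R.tierIndex_le_iff, not_le]

theorem WeakPref.tierIndex_lt_numTiers (a : α) : R.tierIndex a < R.numTiers := by
  classical
  refine Finset.card_lt_card ⟨Finset.image_subset_image (Finset.filter_subset _ _), fun hsub => ?_⟩
  obtain ⟨c, hc, hca⟩ := Finset.mem_image.1 (hsub (Finset.mem_image_of_mem _ (Finset.mem_univ a)))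
  have hac : a ∈ R.tierOf a := Finset.mem_filter.2 ⟨Finset.mem_univ a, R.refl a, R.refl a⟩
  rw [← hca] at hac
  exact (Finset.mem_filter.1 hc).2.2 (Finset.mem_filter.1 hac).2.2

end Tiers

/-- Utility assignments exist: count the alternatives that are at most as good. -/
theorem nonempty_utilityAssignment (P Q : Type*) [Fintype P] :
    Nonempty (UtilityAssignment P Q) := by
  classical
  let c : (Q → WeakPref (Option P)) → Q → Option P → Finset (Option P) := fun W q a =>
    Finset.univ.filter fun b => (W q).rel a b
  refine ⟨⟨fun W q a => ((c W q a).card : ℝ) - (c W q none).card, fun W q => sub_self _, ?_⟩⟩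
  intro W q a b
  rw [sub_le_sub_iff_right, Nat.cast_le]
  constructor
  · intro h
    refine Finset.card_le_card fun x hx => ?_
    simp only [c, Finset.mem_filter, Finset.mem_univ, true_and] at hx ⊢
    exact (W q).trans _ _ _ h hx
  · intro h
    by_contra hab
    have hba := ((W q).total a b).resolve_left hab
    refine absurd h (not_le.2 (Finset.card_lt_card ⟨fun x hx => ?_, fun hsub => hab ?_⟩))
    · simp only [c, Finset.mem_filter, Finset.mem_univ, true_and] at hx ⊢
      exact (W q).trans _ _ _ hba hx
    · have : b ∈ c W q a := hsub (by simp [c, (W q).refl b])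
      simpa [c] using this

/-! ### The bidders of the men -/

section

variable {m n : ℕ}

/-- The ID encodes the man and the tier number, so this works even across different preferences, as
the comparison of two runs requires. -/
theorem manBidder_inj {R R' : WeakPref (Option (Fin n))} {ψ ψ' : Fin n → Option (Fin m) → ℝ}
    {i i' : Fin m} {k k' : ℕ} (h : manBidder R ψ i k = manBidder R' ψ' i' k') :
    i = i' ∧ k = k' := by
  have h' : (Nat.pair i k : ℕ) = Nat.pair i' k' :=
    Nat.cast_injective (R := ℤ) (congrArg Bidder.id h)
  have := Nat.pair_eq_pair.1 h'
  exact ⟨Fin.ext this.1, this.2⟩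

theorem itemOf_injective (i : Fin m) : Function.Injective (itemOf (n := n) i) := by
  rintro (_ | a) (_ | b) h <;> simp_all [itemOf]

theorem manBidder_bid_itemOf {R : WeakPref (Option (Fin n))} {ψ : Fin n → Option (Fin m) → ℝ}
    {i : Fin m} {k : ℕ} {a : Option (Fin n)} :
    ((manBidder R ψ i k).bid (itemOf i a)).isSome ↔ R.tierIndex a = k := by
  cases a <;> simp [manBidder, itemOf]

theorem exists_itemOf_of_bid {R : WeakPref (Option (Fin n))} {ψ : Fin n → Option (Fin m) → ℝ}
    {i : Fin m} {k : ℕ} {v : Item m n} (h : ((manBidder R ψ i k).bid v).isSome) :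
    ∃ a, R.tierIndex a = k ∧ v = itemOf i a := by
  rcases v with j | i'
  · exact ⟨some j, by simpa using (manBidder_bid_itemOf (a := some j)).1 h, rfl⟩
  · have : i' = i := by
      by_contra hne
      simp [manBidder, hne] at h
    subst this
    exact ⟨none, (manBidder_bid_itemOf (a := none)).1 h, rfl⟩

/-- The value of the partner to the alternative `a` of the man `i`. -/
def value (ψ : Fin n → Option (Fin m) → ℝ) (i : Fin m) : Option (Fin n) → ℝ
  | some j => ψ j (some i)
  | none => 0

theorem manBidder_weight {R : WeakPref (Option (Fin n))} {ψ : Fin n → Option (Fin m) → ℝ}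
    {i : Fin m} {k : ℕ} {a : Option (Fin n)} (h : R.tierIndex a = k) :
    (manBidder R ψ i k).weight (itemOf i a) = value ψ i a := by
  cases a <;> simp [Bidder.weight, manBidder, itemOf, value, h]

theorem manBidder_priority (R : WeakPref (Option (Fin n))) (ψ : Fin n → Option (Fin m) → ℝ)
    (i : Fin m) (k : ℕ) : (manBidder R ψ i k).priority = (i : ℝ) + 1 := rfl

/-- The bidder of the man `i` for his tier `k`. -/
noncomputable abbrev tierBidder (Ψ : UtilityAssignment (Fin m) (Fin n))
    (I : Profile (Fin m) (Fin n)) (i : Fin m) (k : ℕ) : Bidder (Item m n) :=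
  manBidder (I.men i) (Ψ.util I.women) i k

variable {Ψ : UtilityAssignment (Fin m) (Fin n)} {I : Profile (Fin m) (Fin n)}

theorem mem_manMultibidder {i : Fin m} {u : Bidder (Item m n)} :
    u ∈ (manMultibidder (I.men i) (Ψ.util I.women) i).seq ↔
      ∃ k < (I.men i).numTiers, u = tierBidder Ψ I i k := by
  simp [manMultibidder, eq_comm]

theorem mem_smiwIUAP_bidders {u : Bidder (Item m n)} :
    u ∈ (smiwIUAP Ψ I).bidders ↔ ∃ i, ∃ k < (I.men i).numTiers, u = tierBidder Ψ I i k := by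
  rw [IUAP.mem_bidders]
  constructor
  · rintro ⟨t, ht, hu⟩
    obtain ⟨i, -, rfl⟩ := Finset.mem_image.1 ht
    exact ⟨i, mem_manMultibidder.1 hu⟩
  · rintro ⟨i, hi⟩
    exact ⟨_, Finset.mem_image_of_mem _ (Finset.mem_univ i), mem_manMultibidder.2 hi⟩

/-! ### Configurations of the procedure -/

namespace IUAP.Config

/-- The number of tiers that the man `i` has revealed. -/
noncomputable def count (C : Config (smiwIUAP Ψ I)) (i : Fin m) : ℕ :=
  (C.uap.bidders ∩ (manMultibidder (I.men i) (Ψ.util I.women) i).bidders).card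

/-- `IsPrefix` yields some prefix length; as the bidders of a man are distinct, their number
identifies it. -/
theorem count_spec (C : Config (smiwIUAP Ψ I)) (i : Fin m) :
    C.count i ≤ (I.men i).numTiers ∧
      C.uap.bidders ∩ (manMultibidder (I.men i) (Ψ.util I.women) i).bidders =
        ((List.range (C.count i)).map (tierBidder Ψ I i)).toFinset := by
  obtain ⟨k, hk, h⟩ := C.isPrefix.2 _ (Finset.mem_image_of_mem _ (Finset.mem_univ i))
  have hk' : k ≤ (I.men i).numTiers := by simpa [manMultibidder] using hk
  have htake : (manMultibidder (I.men i) (Ψ.util I.women) i).seq.take k =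
      (List.range k).map (tierBidder Ψ I i) := by
    simp only [manMultibidder, ← List.map_take, List.take_range, min_eq_left hk']
  rw [htake] at h
  have hc : C.count i = k := by
    rw [count, h, List.toFinset_card_of_nodup]
    · simp
    · exact List.Nodup.map (fun a b hab => (manBidder_inj hab).2) List.nodup_range
  rw [hc]
  exact ⟨hk', h⟩

theorem count_le (C : Config (smiwIUAP Ψ I)) (i : Fin m) : C.count i ≤ (I.men i).numTiers :=
  (C.count_spec i).1

theorem tierBidder_mem {C : Config (smiwIUAP Ψ I)} {i : Fin m} {k : ℕ} :
    tierBidder Ψ I i k ∈ C.uap.bidders ↔ k < C.count i := by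
  have hspec := (C.count_spec i).2
  have hmem : tierBidder Ψ I i k ∈ ((List.range (C.count i)).map (tierBidder Ψ I i)).toFinset ↔
      k < C.count i := by
    rw [List.mem_toFinset, List.mem_map]
    constructor
    · rintro ⟨l, hl, h⟩
      rw [← (manBidder_inj h).2]
      exact List.mem_range.1 hl
    · exact fun h => ⟨k, List.mem_range.2 h, rfl⟩
  rw [← hmem, ← hspec, Finset.mem_inter]
  refine ⟨fun h => ⟨h, ?_⟩, fun h => h.1⟩
  obtain ⟨i', k', hk', h'⟩ := mem_smiwIUAP_bidders.1 (C.isPrefix.1 h)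
  obtain ⟨rfl, rfl⟩ := manBidder_inj h'
  exact List.mem_toFinset.2 (mem_manMultibidder.2 ⟨k, hk', rfl⟩)

theorem mem_uap_bidders {C : Config (smiwIUAP Ψ I)} {u : Bidder (Item m n)} :
    u ∈ C.uap.bidders ↔ ∃ i, ∃ k < C.count i, u = tierBidder Ψ I i k := by
  constructor
  · intro h
    obtain ⟨i, k, -, rfl⟩ := mem_smiwIUAP_bidders.1 (C.isPrefix.1 h)
    exact ⟨i, k, tierBidder_mem.1 h, rfl⟩
  · rintro ⟨i, k, hk, rfl⟩
    exact tierBidder_mem.2 hk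

theorem priority_pos (C : Config (smiwIUAP Ψ I)) : ∀ u ∈ C.uap.bidders, 0 < u.priority := by
  intro u hu
  obtain ⟨i, k, -, rfl⟩ := mem_uap_bidders.1 hu
  rw [manBidder_priority]
  positivity

theorem eq_tierBidder_of_priority_eq {C : Config (smiwIUAP Ψ I)} {u : Bidder (Item m n)}
    (hu : u ∈ C.uap.bidders) {i : Fin m} (h : u.priority = (i : ℝ) + 1) :
    ∃ k < C.count i, u = tierBidder Ψ I i k := by
  obtain ⟨i', k, hk, rfl⟩ := mem_uap_bidders.1 hu
  rw [manBidder_priority] at h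
  obtain rfl : i' = i := Fin.ext (by exact_mod_cast add_right_cancel h)
  exact ⟨k, hk, rfl⟩

/-- The man `i` has a ready bidder. -/
def Ready (C : Config (smiwIUAP Ψ I)) (i : Fin m) : Prop :=
  C.count i < (I.men i).numTiers ∧ ∀ k < C.count i, ¬ C.uap.Alive (tierBidder Ψ I i k)

/-- Bidders of equal priority belong to the same man, so the readiness test says that all his
revealed bidders are dead. -/
theorem mem_ready_iff {C : Config (smiwIUAP Ψ I)} {u : Bidder (Item m n)} :
    u ∈ C.ready ↔ ∃ i, C.Ready i ∧ u = tierBidder Ψ I i (C.count i) := by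
  constructor
  · rintro ⟨-, hc, t, ht, -, hget⟩
    obtain ⟨i, -, rfl⟩ := Finset.mem_image.1 ht
    change (manMultibidder (I.men i) (Ψ.util I.women) i).seq[C.count i]? = some u at hget
    simp only [manMultibidder, List.getElem?_map, Option.map_eq_some_iff,
      List.getElem?_eq_some_iff, List.length_range, List.getElem_range] at hget
    obtain ⟨k, ⟨hlt, rfl⟩, rfl⟩ := hget
    refine ⟨i, ⟨hlt, ?_⟩, rfl⟩
    rintro k - ⟨M, hM, hk⟩
    have := hc M ((UAP.isGreedyMWM_iff C.priority_pos).2 hM)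
    rw [UAP.priorityCount, Finset.card_eq_zero, Finset.filter_eq_empty_iff] at this
    exact this hk rfl
  · rintro ⟨i, ⟨hlt, hdead⟩, rfl⟩
    refine ⟨mem_smiwIUAP_bidders.2 ⟨i, _, hlt, rfl⟩, ?_, _,
      Finset.mem_image_of_mem _ (Finset.mem_univ i), mem_manMultibidder.2 ⟨_, hlt, rfl⟩, ?_⟩
    · intro M hM
      have hM := (UAP.isGreedyMWM_iff C.priority_pos).1 hM
      rw [UAP.priorityCount, Finset.card_eq_zero, Finset.filter_eq_empty_iff]
      intro u hu hpr
      obtain ⟨k, hk, rfl⟩ := eq_tierBidder_of_priority_eq (hM.1.matched_subset hu) hpr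
      exact hdead k hk ⟨M, hM, hu⟩
    · change (manMultibidder (I.men i) (Ψ.util I.women) i).seq[C.count i]? = _
      simp [manMultibidder, hlt]

theorem ready_eq_empty_iff {C : Config (smiwIUAP Ψ I)} : C.ready = ∅ ↔ ∀ i, ¬ C.Ready i := by
  simp only [Set.eq_empty_iff_forall_notMem, mem_ready_iff]
  grind

theorem count_reveal {C : Config (smiwIUAP Ψ I)} {i : Fin m}
    (hu : tierBidder Ψ I i (C.count i) ∈ C.ready) :
    (C.reveal _ hu).count = Function.update C.count i (C.count i + 1) := by
  funext j
  refine eq_of_forall_lt_iff fun k => ?_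
  rw [← tierBidder_mem]
  change tierBidder Ψ I j k ∈ insert (tierBidder Ψ I i (C.count i)) C.uap.bidders ↔ _
  rw [Finset.mem_insert, tierBidder_mem]
  by_cases hij : j = i
  · subst hij
    rw [Function.update_self]
    constructor
    · rintro (h | h)
      · have := (manBidder_inj h).2
        omega
      · omega
    · intro h
      rcases Nat.lt_succ_iff_lt_or_eq.1 h with h | h
      · exact Or.inr h
      · exact Or.inl (by rw [h])
  · rw [Function.update_of_ne hij]
    exact ⟨fun h => h.resolve_left fun h => hij (manBidder_inj h).1, Or.inr⟩

/-- A step reveals the next bidder of a man who has a ready bidder. -/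
theorem Step.exists_ready {C C' : Config (smiwIUAP Ψ I)} (h : C.Step C') :
    ∃ i, C.Ready i ∧ C'.count = Function.update C.count i (C.count i + 1) ∧
      C.uap.bidders ⊆ C'.uap.bidders := by
  obtain ⟨u, hu, rfl⟩ := h
  obtain ⟨i, hi, rfl⟩ := mem_ready_iff.1 hu
  exact ⟨i, hi, count_reveal hu, Finset.subset_insert _ _⟩

theorem Ready.exists_step {C : Config (smiwIUAP Ψ I)} {i : Fin m} (h : C.Ready i) :
    ∃ C', C.Step C' :=
  ⟨_, _, mem_ready_iff.2 ⟨i, h, rfl⟩, rfl⟩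

theorem count_init (i : Fin m) : (init (smiwIUAP Ψ I)).count i = 0 := by
  simp [count, init]

/-- The total number of revealed bidders. -/
noncomputable def total (C : Config (smiwIUAP Ψ I)) : ℕ := ∑ i, C.count i

theorem total_le (C : Config (smiwIUAP Ψ I)) : C.total ≤ ∑ i, (I.men i).numTiers :=
  Finset.sum_le_sum fun i _ => C.count_le i

theorem Step.total_lt {C C' : Config (smiwIUAP Ψ I)} (h : C.Step C') : C.total < C'.total := by
  obtain ⟨i, -, hc, -⟩ := h.exists_ready
  refine Finset.sum_lt_sum (fun j _ => ?_) ⟨i, Finset.mem_univ i, ?_⟩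
  · rw [hc, Function.update_apply]
    split_ifs with hj
    · rw [hj]
      omega
    · exact le_rfl
  · rw [hc, Function.update_self]
    omega

/-- The number of revealed bidders grows at each step and is bounded by the total number of tiers.
-/
theorem toUapTerminates : ToUapTerminates (smiwIUAP Ψ I) := by
  rintro ⟨C, -, hC⟩
  have hle : ∀ k, k ≤ (C k).total := by
    intro k
    induction k with
    | zero => exact Nat.zero_le _
    | succ k ih => exact Nat.succ_le_of_lt (ih.trans_lt (hC k).total_lt)
  have := (hle (∑ i, (I.men i).numTiers + 1)).trans (total_le _)
  omega

/-- Configurations reached by executions of `ToUap`. -/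
def Reachable (C : Config (smiwIUAP Ψ I)) : Prop := Relation.ReflTransGen Step (init _) C

/-- From a reachable configuration, the procedure can go on until it returns. -/
theorem Reachable.exists_final {C : Config (smiwIUAP Ψ I)} (hC : C.Reachable) :
    ∃ C' : Config (smiwIUAP Ψ I), C'.Reachable ∧ ∀ i, ¬ C'.Ready i := by
  induction hk : ∑ i, (I.men i).numTiers - C.total using Nat.strong_induction_on generalizing C with
  | _ k ih =>
    by_cases h : ∃ i, C.Ready i
    · obtain ⟨i, hready⟩ := h
      obtain ⟨C₁, hstep⟩ := hready.exists_step
      have hlt := hstep.total_lt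
      have hle := C₁.total_le
      exact ih _ (by omega) (hC.tail hstep) rfl
    · exact ⟨C, hC, not_exists.1 h⟩

/-- If a man has revealed his tier `k`, then there was a configuration in which he was about to do
so, and none of his bidders was matched. -/
theorem Reachable.exists_count_eq {C : Config (smiwIUAP Ψ I)} (hC : C.Reachable) {i : Fin m}
    {k : ℕ} (hk : k < C.count i) : ∃ C' : Config (smiwIUAP Ψ I), C'.Reachable ∧ C'.count i = k ∧
      ∀ l < k, ¬ C'.uap.Alive (tierBidder Ψ I i l) := by
  induction hC with
  | refl => simp [count_init] at hk
  | @tail C₁ C₂ h hstep ih =>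
    by_cases hlt : k < C₁.count i
    · exact ih hlt
    obtain ⟨j, hj, hcount, -⟩ := hstep.exists_ready
    by_cases hij : i = j
    · subst hij
      rw [hcount, Function.update_self] at hk
      obtain rfl : k = C₁.count i := by omega
      exact ⟨C₁, h, rfl, hj.2⟩
    · rw [hcount, Function.update_of_ne hij] at hk
      exact absurd hk hlt

/-- Only the last revealed bidder of a man can be matched. -/
theorem Reachable.not_alive {C : Config (smiwIUAP Ψ I)} (hC : C.Reachable) {i : Fin m} {k : ℕ}
    (hk : k + 1 < C.count i) : ¬ C.uap.Alive (tierBidder Ψ I i k) := by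
  induction hC with
  | refl => simp [count_init] at hk
  | @tail C₁ C₂ h hstep ih =>
    obtain ⟨j, hj, hcount, hsub⟩ := hstep.exists_ready
    have hlt : k < C₁.count i := by
      rw [hcount, Function.update_apply] at hk
      split_ifs at hk with hij
      · subst hij
        omega
      · omega
    -- Being dead before the step suffices. If `i` reveals in this step, his readiness gives it;
    -- otherwise the induction hypothesis does.
    refine fun halive => absurd (halive.anti hsub (tierBidder_mem.2 hlt)) ?_
    by_cases hij : i = j
    · subst hij
      exact hj.2 k hlt
    · rw [hcount, Function.update_of_ne hij] at hk
      exact ih hk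

theorem Reachable.eq_last {C : Config (smiwIUAP Ψ I)} (hC : C.Reachable)
    {M : Finset (Bidder (Item m n) × Item m n)} (hM : C.uap.IsOpt M) {i : Fin m} {k : ℕ}
    (hk : tierBidder Ψ I i k ∈ UAP.matched M) : k + 1 = C.count i := by
  have hlt := tierBidder_mem.1 (hM.1.matched_subset hk)
  by_contra hne
  exact hC.not_alive (by omega) ⟨M, hM, hk⟩

/-- Once revealed, the bidder of a man for the tier of being unmatched is matched. -/
theorem tierBidder_none_mem_matched {C : Config (smiwIUAP Ψ I)}
    {M : Finset (Bidder (Item m n) × Item m n)} (hM : C.uap.IsOpt M) {i : Fin m}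
    (hi : (I.men i).tierIndex none < C.count i) :
    tierBidder Ψ I i ((I.men i).tierIndex none) ∈ UAP.matched M := by
  classical
  set u := tierBidder Ψ I i ((I.men i).tierIndex none)
  by_contra hu
  -- Nobody but `i` bids on his dummy item, and he does so with `u` only.
  have hnot : ∀ u', (u', itemOf i none) ∉ M := by
    intro u' hu'
    have hmem := hM.1.edge _ hu'
    obtain ⟨i', k, -, rfl⟩ := mem_uap_bidders.1 hmem.1
    obtain ⟨a, ha, ha'⟩ := exists_itemOf_of_bid hmem.2
    cases a with
    | some a => simp [itemOf] at ha'
    | none =>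
      obtain rfl : i = i' := by simpa [itemOf] using ha'
      subst ha
      exact hu (UAP.mem_matched.2 ⟨_, hu'⟩)
  have hM' := UAP.isMatching_iff.1 hM.1
  have hnew : C.uap.IsMatching (insert (u, itemOf i none) M) := by
    refine UAP.isMatching_iff.2 ⟨hM'.1.insert hu hnot, fun x v h => ?_⟩
    rw [Finset.mem_insert, Prod.mk.injEq] at h
    rcases h with ⟨rfl, rfl⟩ | h
    · exact ⟨tierBidder_mem.2 hi, manBidder_bid_itemOf.2 rfl⟩
    · exact hM'.2 _ _ h
  -- The added edge has weight 0 and positive priority, so it improves the lexicographic value.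
  have hle := hM.2 _ hnew
  rw [UAP.lexWeight, Finset.sum_insert (hnot _), ← UAP.lexWeight, add_le_iff_nonpos_left,
    UAP.lexEdge, manBidder_weight rfl] at hle
  rw [show (0 : ℝ ×ₗ ℝ) = toLex (0, 0) from rfl, Prod.Lex.toLex_le_toLex] at hle
  rcases hle with h | h
  · simp [value] at h
  · have := h.2
    simp only [u, manBidder_priority] at this
    have h0 : (0 : ℝ) ≤ (i : ℕ) := Nat.cast_nonneg _
    linarith

/-- A man without a ready bidder is matched by his last revealed bidder. -/
theorem Reachable.last_mem_matched {C : Config (smiwIUAP Ψ I)} (hC : C.Reachable) {i : Fin m}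
    (hi : ¬ C.Ready i) {M : Finset (Bidder (Item m n) × Item m n)} (hM : C.uap.IsOpt M) :
    ∃ k, k + 1 = C.count i ∧ tierBidder Ψ I i k ∈ UAP.matched M := by
  by_cases hlt : C.count i < (I.men i).numTiers
  -- With tiers left, not being ready means that a revealed bidder is matched in some optimal
  -- matching; its priority is then matched in `M` too.
  · simp only [Ready, not_and, not_forall, not_not] at hi
    obtain ⟨k, hk, M₂, hM₂, hk₂⟩ := hi hlt
    obtain ⟨c, hc, hpr⟩ := hM.exists_priority_eq C.priority_pos hM₂ hk₂
    obtain ⟨l, hl, rfl⟩ := eq_tierBidder_of_priority_eq (hM.1.matched_subset hc) hpr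
    exact ⟨l, hC.eq_last hM hc, hc⟩
  · have hmem := tierBidder_none_mem_matched hM
      (((I.men i).tierIndex_lt_numTiers none).trans_le (not_lt.1 hlt))
    exact ⟨_, hC.eq_last hM hmem, hmem⟩

/-- No man reveals bidders beyond the tier of being unmatched. -/
theorem Reachable.count_le_succ {C : Config (smiwIUAP Ψ I)} (hC : C.Reachable) (i : Fin m) :
    C.count i ≤ (I.men i).tierIndex none + 1 := by
  by_contra h
  obtain ⟨M, hM⟩ := C.uap.exists_isOpt
  have := hC.eq_last hM (tierBidder_none_mem_matched hM (show _ < C.count i by omega))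
  omega

end IUAP.Config

end

/-! ### Matchings of men and women as sets of edges -/

variable {m n : ℕ} {Ψ : UtilityAssignment (Fin m) (Fin n)} {I : Profile (Fin m) (Fin n)}

theorem Matching.woman_eq_some_iff {P Q : Type*} {μ : Matching P Q} {p : P} {q : Q} :
    μ.woman q = some p ↔ μ.man p = some q := by
  classical
  unfold Matching.woman
  split_ifs with h
  · rw [Option.some.injEq]
    exact ⟨fun hp => hp ▸ h.choose_spec, fun hp => μ.inj _ _ _ h.choose_spec hp⟩
  · exact ⟨fun h' => by simp at h', fun h' => absurd ⟨p, h'⟩ h⟩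

/-- The total value of a matching, summed over the men and over the women. -/
theorem sum_value_eq (μ : Matching (Fin m) (Fin n)) (W : Fin n → WeakPref (Option (Fin m))) :
    ∑ i, value (Ψ.util W) i (μ.man i) = ∑ j, Ψ.util W j (μ.woman j) := by
  have hv : ∀ i, value (Ψ.util W) i (μ.man i) =
      ∑ j, if μ.man i = some j then Ψ.util W j (some i) else 0 := by
    intro i
    cases h : μ.man i with
    | none => simp [value]
    | some j => simp [value]
  simp only [hv]
  rw [Finset.sum_comm]
  refine Finset.sum_congr rfl fun j _ => ?_
  cases h : μ.woman j with
  | none =>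
    rw [Ψ.util_none]
    refine Finset.sum_eq_zero fun i _ => if_neg fun hi => ?_
    rw [Matching.woman_eq_some_iff.2 hi] at h
    simp at h
  | some p =>
    have hp := Matching.woman_eq_some_iff.1 h
    rw [Finset.sum_eq_single p, if_pos hp]
    · exact fun i _ hi => if_neg fun hi' => hi (μ.inj _ _ _ hi' hp)
    · simp

/-- The edge by which the man `i` gets the alternative `a`. -/
noncomputable def tierEdge (Ψ : UtilityAssignment (Fin m) (Fin n)) (I : Profile (Fin m) (Fin n))
    (i : Fin m) (a : Option (Fin n)) : Bidder (Item m n) × Item m n :=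
  (tierBidder Ψ I i ((I.men i).tierIndex a), itemOf i a)

/-- The men's preferences decide which bidder makes an offer, not what it is worth. This is what
lets a misreported bidder be replaced by the truthful one. -/
theorem lexEdge_tierEdge (i : Fin m) (a : Option (Fin n)) :
    UAP.lexEdge (tierEdge Ψ I i a) = toLex (value (Ψ.util I.women) i a, (i : ℝ) + 1) := by
  rw [UAP.lexEdge, tierEdge, manBidder_weight rfl, manBidder_priority]

/-- The edges by which the men get their alternatives in `μ`. -/
noncomputable def tierEdges (Ψ : UtilityAssignment (Fin m) (Fin n))
    (I : Profile (Fin m) (Fin n)) (μ : Matching (Fin m) (Fin n)) :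
    Finset (Bidder (Item m n) × Item m n) :=
  Finset.univ.image fun i => tierEdge Ψ I i (μ.man i)

theorem mem_tierEdges {μ : Matching (Fin m) (Fin n)}
    {e : Bidder (Item m n) × Item m n} :
    e ∈ tierEdges Ψ I μ ↔ ∃ i, e = tierEdge Ψ I i (μ.man i) := by
  simp [tierEdges, eq_comm]

theorem tierEdge_injective (μ : Matching (Fin m) (Fin n)) :
    Function.Injective fun i => tierEdge Ψ I i (μ.man i) :=
  fun _ _ h => (manBidder_inj (congrArg Prod.fst h)).1

theorem weight_tierEdges (μ : Matching (Fin m) (Fin n)) :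
    UAP.weight (tierEdges Ψ I μ) = ∑ j, Ψ.util I.women j (μ.woman j) := by
  rw [← sum_value_eq, UAP.weight, tierEdges,
    Finset.sum_image (tierEdge_injective μ).injOn]
  exact Finset.sum_congr rfl fun i _ => manBidder_weight rfl

theorem isEdgeMatching_tierEdges (μ : Matching (Fin m) (Fin n)) :
    UAP.IsEdgeMatching (tierEdges Ψ I μ) := by
  constructor
  · intro u v v' h h'
    obtain ⟨i, hi⟩ := mem_tierEdges.1 h
    obtain ⟨i', hi'⟩ := mem_tierEdges.1 h'
    obtain rfl : i = i' :=
      (manBidder_inj ((congrArg Prod.fst hi).symm.trans (congrArg Prod.fst hi'))).1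
    exact congrArg Prod.snd (hi.trans hi'.symm)
  · intro u u' v h h'
    obtain ⟨i, hi⟩ := mem_tierEdges.1 h
    obtain ⟨i', hi'⟩ := mem_tierEdges.1 h'
    obtain rfl : i = i' := by
      have hv : itemOf i (μ.man i) = itemOf i' (μ.man i') :=
        (congrArg Prod.snd hi).symm.trans (congrArg Prod.snd hi')
      cases h₁ : μ.man i <;> cases h₂ : μ.man i' <;> simp only [h₁, h₂, itemOf] at hv
      · exact Sum.inr_injective hv
      · simp at hv
      · simp at hv
      · exact μ.inj _ _ _ h₁ (Sum.inl_injective hv ▸ h₂)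
    exact congrArg Prod.fst (hi.trans hi'.symm)

/-- Every man is matched, to his dummy item if need be, so the priority component does not depend on
`μ`. -/
theorem lexWeight_tierEdges (μ : Matching (Fin m) (Fin n)) :
    UAP.lexWeight (tierEdges Ψ I μ) =
      toLex (∑ j, Ψ.util I.women j (μ.woman j), ∑ i : Fin m, ((i : ℝ) + 1)) := by
  rw [UAP.lexWeight_eq (isEdgeMatching_tierEdges μ), weight_tierEdges]
  congr 2
  have : UAP.matched (tierEdges Ψ I μ) =
      Finset.univ.image fun i => tierBidder Ψ I i ((I.men i).tierIndex (μ.man i)) := by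
    ext u
    simp only [UAP.mem_matched, mem_tierEdges, Finset.mem_image, Finset.mem_univ, true_and]
    exact ⟨fun ⟨v, i, h⟩ => ⟨i, (congrArg Prod.fst h).symm⟩, fun ⟨i, h⟩ => ⟨_, i, Prod.ext h.symm rfl⟩⟩
  rw [this, UAP.setPriority, Finset.sum_image fun _ _ _ _ h => (manBidder_inj h).1]
  rfl

/-! ### Reading a matching off an optimal set of edges -/

open IUAP.Config

namespace IUAP.Config

variable {C : Config (smiwIUAP Ψ I)} {M : Finset (Bidder (Item m n) × Item m n)}

theorem eq_tierEdge {e : Bidder (Item m n) × Item m n} (hM : C.uap.IsMatching M) (he : e ∈ M) :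
    ∃ i a, e = tierEdge Ψ I i a := by
  obtain ⟨u, v⟩ := e
  have h := hM.edge _ he
  obtain ⟨i, k, -, rfl⟩ := mem_uap_bidders.1 h.1
  obtain ⟨a, rfl, rfl⟩ := exists_itemOf_of_bid h.2
  exact ⟨i, a, rfl⟩

theorem readOff_iff (hM : C.uap.IsMatching M) {μ : Matching (Fin m) (Fin n)} :
    ReadOff Ψ I M μ ↔ ∀ i a, μ.man i = a ↔ tierEdge Ψ I i a ∈ M := by
  refine forall_congr' fun i => forall_congr' fun a => iff_congr Iff.rfl ?_
  constructor
  · rintro ⟨u, hu, huM⟩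
    obtain ⟨k, -, rfl⟩ := mem_manMultibidder.1 hu
    have := manBidder_bid_itemOf.1 (hM.edge _ huM).2
    subst this
    exact huM
  · exact fun h => ⟨_, mem_manMultibidder.2 ⟨_, (I.men i).tierIndex_lt_numTiers a, rfl⟩, h⟩

theorem Reachable.tierIndex_eq (hC : C.Reachable) (hM : C.uap.IsOpt M) {i : Fin m}
    {a : Option (Fin n)} (h : tierEdge Ψ I i a ∈ M) : (I.men i).tierIndex a + 1 = C.count i :=
  hC.eq_last hM (UAP.mem_matched.2 ⟨_, h⟩)

/-- Two such alternatives would both lie in the last revealed tier, hence belong to one bidder,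
which holds one item. -/
theorem Reachable.existsUnique_tierEdge (hC : C.Reachable) (hM : C.uap.IsOpt M) {i : Fin m}
    (hi : ¬ C.Ready i) : ∃! a, tierEdge Ψ I i a ∈ M := by
  obtain ⟨k, -, hk⟩ := hC.last_mem_matched hi hM
  obtain ⟨v, hv⟩ := UAP.mem_matched.1 hk
  obtain ⟨a, rfl, rfl⟩ := exists_itemOf_of_bid (hM.1.edge _ hv).2
  refine ⟨a, hv, fun b hb => ?_⟩
  have hab := (hC.tierIndex_eq hM hb).trans (hC.tierIndex_eq hM hv).symm
  refine itemOf_injective i (hM.1.isEdgeMatching.item_eq _ _ _ ?_ hv)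
  rw [← add_right_cancel hab]
  exact hb

theorem Reachable.existsUnique_readOff (hC : C.Reachable) (hready : ∀ i, ¬ C.Ready i)
    (hM : C.uap.IsOpt M) : ∃! μ, ReadOff Ψ I M μ := by
  choose f hf hf' using fun i => hC.existsUnique_tierEdge hM (hready i)
  have hfi : ∀ i a, f i = a ↔ tierEdge Ψ I i a ∈ M := fun i a =>
    ⟨fun h => h ▸ hf i, fun h => (hf' i a h).symm⟩
  refine ⟨⟨f, fun p p' q h h' => ?_⟩, (readOff_iff hM.1).2 hfi, fun μ hμ => ?_⟩
  · exact (manBidder_inj (hM.1.isEdgeMatching.bidder_eq _ _ _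
      ((hfi p (some q)).1 h) ((hfi p' (some q)).1 h'))).1
  · have hμ := (readOff_iff hM.1).1 hμ
    cases μ with
    | mk g _ =>
      congr
      funext i
      exact (hμ i _).2 (hf i)

/-! ### Pareto-stability -/

variable {μ : Matching (Fin m) (Fin n)}

theorem Reachable.paretoOptimal (hC : C.Reachable) (hM : C.uap.IsOpt M)
    (hμ : ∀ i a, μ.man i = a ↔ tierEdge Ψ I i a ∈ M) : μ.ParetoOptimal I := by
  rintro μ' ⟨⟨hmen, hwomen⟩, hnot⟩
  have hcount : ∀ i, (I.men i).tierIndex (μ.man i) + 1 = C.count i := fun i =>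
    hC.tierIndex_eq hM ((hμ i _).1 rfl)
  have hME : M = tierEdges Ψ I μ := by
    ext e
    rw [mem_tierEdges]
    constructor
    · intro he
      obtain ⟨i, a, rfl⟩ := eq_tierEdge hM.1 he
      exact ⟨i, by rw [(hμ i a).2 he]⟩
    · rintro ⟨i, rfl⟩
      exact (hμ i _).1 rfl
  -- No man is worse off in `μ'`, so only revealed tiers are used.
  have hmat : C.uap.IsMatching (tierEdges Ψ I μ') := by
    refine UAP.isMatching_iff.2 ⟨isEdgeMatching_tierEdges μ', fun u v h => ?_⟩
    obtain ⟨i, hi⟩ := mem_tierEdges.1 h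
    obtain ⟨rfl, rfl⟩ := Prod.mk.inj hi
    refine ⟨tierBidder_mem.2 ?_, manBidder_bid_itemOf.2 rfl⟩
    have := (I.men i).tierIndex_le_iff.2 (hmen i)
    have := hcount i
    omega
  have hle : ∀ j ∈ Finset.univ,
      Ψ.util I.women j (μ.woman j) ≤ Ψ.util I.women j (μ'.woman j) := fun j _ =>
    (Ψ.util_le_iff _ _ _ _).1 (hwomen j)
  have hge := hM.isMWM.2 _ hmat
  rw [hME, weight_tierEdges, weight_tierEdges] at hge
  have hsum := (Finset.sum_le_sum hle).antisymm hge
  -- Optimality of `μ'` places its men in their last revealed tiers as well, so none of them has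
  -- gained.
  have hopt : C.uap.IsOpt (tierEdges Ψ I μ') := by
    refine ⟨hmat, fun N hN => (hM.2 N hN).trans_eq ?_⟩
    rw [hME, lexWeight_tierEdges, lexWeight_tierEdges, hsum]
  refine hnot ⟨fun i => ?_, fun j => ?_⟩
  · rw [← (I.men i).tierIndex_le_iff]
    have := hC.tierIndex_eq hopt (mem_tierEdges.2 ⟨i, rfl⟩)
    have := hcount i
    omega
  · rw [Ψ.util_le_iff]
    exact ((Finset.sum_eq_sum_iff_of_le hle).1 hsum j (Finset.mem_univ j)).ge

theorem Reachable.weaklyStable (hC : C.Reachable) (hM : C.uap.IsOpt M)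
    (hμ : ∀ i a, μ.man i = a ↔ tierEdge Ψ I i a ∈ M) : μ.WeaklyStable I := by
  classical
  have hcount : ∀ i, (I.men i).tierIndex (μ.man i) + 1 = C.count i := fun i =>
    hC.tierIndex_eq hM ((hμ i _).1 rfl)
  have hMm := UAP.isMatching_iff.1 hM.1
  have hw : ∀ i j, (tierEdge Ψ I i (some j)).1.weight (tierEdge Ψ I i (some j)).2 =
      Ψ.util I.women j (some i) := fun i j => manBidder_weight rfl
  constructor
  · intro p q hpq
    constructor
    · rw [← (I.men p).tierIndex_le_iff, ← hpq]
      have := hcount p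
      have := hC.count_le_succ p
      omega
    · have he := (hμ p _).1 hpq
      rw [Ψ.util_le_iff, Ψ.util_none, ← hw]
      -- Dropping an edge of negative weight would raise the total weight.
      have hle := hM.isMWM.2 (M.erase (tierEdge Ψ I p (some q)))
        (UAP.isMatching_iff.2 ⟨hMm.1.erase _, fun u v h => hMm.2 _ _ (Finset.mem_of_mem_erase h)⟩)
      have := Finset.add_sum_erase M (fun e => e.1.weight e.2) he
      simp only [UAP.weight] at hle
      linarith
  · rintro p q ⟨hp, hq⟩
    have hlt := (I.men p).tierIndex_lt_iff.2 hp
    -- The bidder for a tier better than that of `μ.man p` is revealed but is not the last one, so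
    -- it is free to take `q`.
    have hu : (tierEdge Ψ I p (some q)).1 ∉ UAP.matched M := by
      intro h
      have := hC.eq_last hM h
      have := hcount p
      omega
    have hedge : (tierEdge Ψ I p (some q)).1 ∈ C.uap.bidders ∧
        ((tierEdge Ψ I p (some q)).1.bid (tierEdge Ψ I p (some q)).2).isSome := by
      refine ⟨tierBidder_mem.2 ?_, manBidder_bid_itemOf.2 rfl⟩
      have := hcount p
      omega
    have hq' : Ψ.util I.women q (μ.woman q) < Ψ.util I.women q (some p) := by
      rw [WeakPref.strict_iff, Ψ.util_le_iff, not_le] at hq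
      exact hq
    cases hwq : μ.woman q with
    | none =>
      have hv : ∀ u', (u', Sum.inl q) ∉ M := by
        intro u' h
        obtain ⟨i, a, hia⟩ := eq_tierEdge hM.1 h
        obtain rfl : a = some q := by
          have := congrArg Prod.snd hia
          cases a <;> simp_all [tierEdge, itemOf]
        rw [hia] at h
        rw [Matching.woman_eq_some_iff.2 ((hμ i _).2 h)] at hwq
        simp at hwq
      have hnot : tierEdge Ψ I p (some q) ∉ M := hv _
      have hnew : C.uap.IsMatching (insert (tierEdge Ψ I p (some q)) M) := by
        refine UAP.isMatching_iff.2 ⟨hMm.1.insert hu hv, fun x y h => ?_⟩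
        rcases Finset.mem_insert.1 h with h | h
        · rw [← h] at hedge
          exact hedge
        · exact hMm.2 _ _ h
      have hle := hM.isMWM.2 _ hnew
      rw [UAP.weight, Finset.sum_insert hnot, hw] at hle
      rw [hwq, Ψ.util_none] at hq'
      simp only [UAP.weight] at hle
      linarith
    | some p' =>
      have he := (hμ p' _).1 (Matching.woman_eq_some_iff.1 hwq)
      have hu' : (tierEdge Ψ I p (some q)).1 ∉
          UAP.matched (M.erase (tierEdge Ψ I p' (some q))) := fun h =>
        hu (UAP.matched_mono (Finset.erase_subset _ _) h)
      have hnot : tierEdge Ψ I p (some q) ∉ M.erase (tierEdge Ψ I p' (some q)) := fun h =>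
        hu' (UAP.mem_matched.2 ⟨_, h⟩)
      have hnew : C.uap.IsMatching
          (insert (tierEdge Ψ I p (some q)) (M.erase (tierEdge Ψ I p' (some q)))) := by
        refine UAP.isMatching_iff.2 ⟨hMm.1.replace he hu', fun x y h => ?_⟩
        rcases Finset.mem_insert.1 h with h | h
        · rw [← h] at hedge
          exact hedge
        · exact hMm.2 _ _ (Finset.mem_of_mem_erase h)
      have hle := hM.isMWM.2 _ hnew
      have hadd := Finset.add_sum_erase M (fun e => e.1.weight e.2) he
      rw [UAP.weight, Finset.sum_insert hnot, hw] at hle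
      rw [hw] at hadd
      rw [hwq] at hq'
      simp only [UAP.weight] at hle
      linarith

end IUAP.Config

/-! ### Strategyproofness -/

theorem Profile.withMan_men_of_ne {p i : Fin m} (h : i ≠ p) (R : WeakPref (Option (Fin n))) :
    (I.withMan p R).men i = I.men i := by
  simp [Profile.withMan, h]

/-- The utilities depend on the women's preferences alone, which a man's misreport leaves unchanged.
-/
theorem tierBidder_withMan_of_ne {p i : Fin m} (h : i ≠ p) (R : WeakPref (Option (Fin n)))
    (k : ℕ) : tierBidder Ψ (I.withMan p R) i k = tierBidder Ψ I i k := by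
  simp only [tierBidder, Profile.withMan_men_of_ne h]
  rfl

/-- A man `p` who changes his preferences to `R` does not get an alternative that he prefers to
his tier `k`, if he reveals his tier `k` in the truthful execution. -/
theorem not_tierEdge_mem_of_tierIndex_lt {C : IUAP.Config (smiwIUAP Ψ I)} (hC : C.Reachable)
    {p : Fin m} {R : WeakPref (Option (Fin n))}
    {C' : IUAP.Config (smiwIUAP Ψ (I.withMan p R))} (hC' : C'.Reachable)
    (hready' : ∀ i, ¬ C'.Ready i) {M' : Finset (Bidder (Item m n) × Item m n)}
    (hM' : C'.uap.IsOpt M') {a : Option (Fin n)} {k : ℕ} (hk : k < C.count p)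
    (ha : (I.men p).tierIndex a < k) : tierEdge Ψ (I.withMan p R) p a ∉ M' := by
  classical
  intro he'
  obtain ⟨F, hF, hcp, hdead⟩ := hC.exists_count_eq hk
  obtain ⟨M₁, hM₁⟩ := F.uap.exists_isOpt
  -- All bidders of `p` revealed in `F` have index below `k` and are dead, so `M₁` matches none of
  -- them.
  have hdead : ∀ l, tierBidder Ψ I p l ∉ UAP.matched M₁ ∧
      (l < k → ¬ F.uap.Alive (tierBidder Ψ I p l)) := by
    refine fun l => ⟨fun h => ?_, hdead l⟩
    exact hdead l (hcp ▸ tierBidder_mem.1 (hM₁.1.matched_subset h)) ⟨M₁, hM₁, h⟩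
  set v := itemOf p a with hv
  set u := tierBidder Ψ I p ((I.men p).tierIndex a) with hu
  set u' := tierBidder Ψ (I.withMan p R) p (((I.withMan p R).men p).tierIndex a) with hu'
  change (u', v) ∈ M' at he'
  have hlex : UAP.lexEdge (u, v) = UAP.lexEdge (u', v) :=
    (lexEdge_tierEdge (Ψ := Ψ) (I := I) p a).trans
      (lexEdge_tierEdge (Ψ := Ψ) (I := I.withMan p R) p a).symm
  have hem₁ := hM₁.1.isEdgeMatching
  have hem' := hM'.1.isEdgeMatching
  -- A bidder of `p` matched in `M'` is his last revealed one, namely `u'`, whose edge has been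
  -- removed.
  have huM' : u ∉ UAP.matched (M'.erase (u', v)) := by
    intro h
    obtain ⟨y, hy⟩ := UAP.mem_matched.1 h
    obtain ⟨hne, hy⟩ := Finset.mem_erase.1 hy
    obtain ⟨i, l, -, hil⟩ := mem_uap_bidders.1 (hM'.1.edge _ hy).1
    obtain ⟨rfl, -⟩ := manBidder_inj hil
    change u = _ at hil
    rw [hil] at hy hne
    have hl := hC'.eq_last hM' (UAP.mem_matched.2 ⟨_, hy⟩)
    have hl' := hC'.eq_last hM' (UAP.mem_matched.2 ⟨_, he'⟩)
    obtain rfl : l = ((I.withMan p R).men p).tierIndex a := by omega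
    exact hne (by rw [hem'.item_eq _ _ _ hy he'])
  set M₂ := insert (u, v) (M'.erase (u', v)) with hM₂
  have hem₂ : UAP.IsEdgeMatching M₂ := hem'.replace he' huM'
  have hw₂ : UAP.lexWeight M₂ = UAP.lexWeight M' := by
    rw [UAP.lexWeight, hM₂, Finset.sum_insert fun h => huM' (UAP.mem_matched.2 ⟨_, h⟩), hlex,
      Finset.add_sum_erase M' UAP.lexEdge he', UAP.lexWeight]
  have hsome : ∀ x y, (x, y) ∈ M₁ ∨ (x, y) ∈ M₂ → (x.bid y).isSome := by
    rintro x y (h | h)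
    · exact (hM₁.1.edge _ h).2
    · rcases Finset.mem_insert.1 h with h | h
      · obtain ⟨rfl, rfl⟩ := Prod.mk.inj h
        exact manBidder_bid_itemOf.2 rfl
      · exact (hM'.1.edge _ (Finset.mem_of_mem_erase h)).2
  have hmatched₂ : UAP.matched M₂ ⊆ insert u C'.uap.bidders := by
    intro x hx
    obtain ⟨y, hy⟩ := UAP.mem_matched.1 hx
    rcases Finset.mem_insert.1 hy with h | h
    · rw [(Prod.mk.inj h).1]
      exact Finset.mem_insert_self _ _
    · exact Finset.mem_insert_of_mem (hM'.1.edge _ (Finset.mem_of_mem_erase h)).1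
  have hbound₁ : ∀ N, UAP.IsEdgeMatching N → (∀ e ∈ N, e ∈ M₁ ∨ e ∈ M₂) →
      UAP.matched N ⊆ F.uap.bidders → ∀ b ∈ UAP.matched N, ¬ F.uap.Alive b →
      UAP.lexWeight N < UAP.lexWeight M₁ := by
    intro N hN hNs hNF b hb hbd
    have hmat : F.uap.IsMatching N := UAP.isMatching_iff.2 ⟨hN, fun x y h =>
      ⟨hNF (UAP.mem_matched.2 ⟨y, h⟩), hsome _ _ (hNs _ h)⟩⟩
    refine lt_of_not_ge fun hge => hbd ⟨N, ⟨hmat, fun N' hN' => (hM₁.2 N' hN').trans hge⟩, hb⟩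
  -- Optimality of `M'` passes to `M₂` by undoing the replacement: if `N` uses `u`, it does so on
  -- `v`, and `u'` can take over at equal value.
  have hbound₂ : ∀ N, UAP.IsEdgeMatching N → (∀ e ∈ N, e ∈ M₁ ∨ e ∈ M₂) →
      UAP.matched N ⊆ insert u C'.uap.bidders → UAP.lexWeight N ≤ UAP.lexWeight M₂ := by
    intro N hN hNs hNC
    rw [hw₂]
    by_cases huN : u ∈ UAP.matched N
    · obtain ⟨y, hy⟩ := UAP.mem_matched.1 huN
      have huM₁ := (hdead ((I.men p).tierIndex a)).1
      have hyv : y = v := by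
        rcases hNs _ hy with h | h
        · exact absurd (UAP.mem_matched.2 ⟨_, h⟩) huM₁
        · exact hem₂.item_eq _ _ _ h (Finset.mem_insert_self _ _)
      rw [hyv] at hy
      have hu'N : u' ∉ UAP.matched (N.erase (u, v)) := by
        intro h
        obtain ⟨z, hz⟩ := UAP.mem_matched.1 h
        obtain ⟨hne, hz⟩ := Finset.mem_erase.1 hz
        rcases hNs _ hz with h | h
        · obtain ⟨i, l, -, hil⟩ := mem_uap_bidders.1 (hM₁.1.edge _ h).1
          obtain ⟨rfl, -⟩ := manBidder_inj hil
          change u' = _ at hil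
          rw [hil] at h
          exact (hdead l).1 (UAP.mem_matched.2 ⟨_, h⟩)
        · rcases Finset.mem_insert.1 h with h | h
          · exact hne h
          · obtain ⟨hne', h⟩ := Finset.mem_erase.1 h
            exact hne' (by rw [hem'.item_eq _ _ _ h he'])
      have hmat : C'.uap.IsMatching (insert (u', v) (N.erase (u, v))) := by
        refine UAP.isMatching_iff.2 ⟨hN.replace hy hu'N, fun x z h => ?_⟩
        rcases Finset.mem_insert.1 h with h | h
        · obtain ⟨rfl, rfl⟩ := Prod.mk.inj h
          exact hM'.1.edge _ he'
        · obtain ⟨hne, h⟩ := Finset.mem_erase.1 h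
          refine ⟨(Finset.mem_insert.1 (hNC (UAP.mem_matched.2 ⟨z, h⟩))).resolve_left ?_,
            hsome _ _ (hNs _ h)⟩
          rintro rfl
          exact hne (by rw [hN.item_eq _ _ _ h hy])
      have hle := hM'.2 _ hmat
      rwa [UAP.lexWeight, Finset.sum_insert fun h => hu'N (UAP.mem_matched.2 ⟨_, h⟩), ← hlex,
        Finset.add_sum_erase N UAP.lexEdge hy] at hle
    · refine hM'.2 _ (UAP.isMatching_iff.2 ⟨hN, fun x y h => ⟨?_, hsome _ _ (hNs _ h)⟩⟩)
      have hx : x ∈ UAP.matched N := UAP.mem_matched.2 ⟨y, h⟩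
      refine (Finset.mem_insert.1 (hNC hx)).resolve_left ?_
      rintro rfl
      exact huN hx
  -- The men other than `p` who reveal more tiers in `F` than in `C'`.
  let X : Finset (Fin m) := Finset.univ.filter fun i => i ≠ p ∧ C'.count i < F.count i
  have hpX : p ∉ X := by simp [X]
  -- Paths start at `u` for `p`, and at the last bidder in `C'` for a man of `X`. His count there is
  -- positive by `last_mem_matched`, so the subtraction is not truncated.
  let t : Fin m → ℕ := fun i => if i = p then (I.men p).tierIndex a else C'.count i - 1
  have hpath : ∀ i, i ∈ insert p X → ∃ i' ∈ X, ∃ c, tierBidder Ψ I i (t i) ∉ UAP.matched M₁ ∧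
      UAP.AltReach M₁ M₂ (tierBidder Ψ I i (t i)) (tierBidder Ψ I i' c) ∧
      c = F.count i' - 1 := by
    intro i hi
    have hb : tierBidder Ψ I i (t i) ∈ F.uap.bidders ∧
        ¬ F.uap.Alive (tierBidder Ψ I i (t i)) ∧ tierBidder Ψ I i (t i) ∈ UAP.matched M₂ := by
      by_cases hip : i = p
      · subst hip
        simp only [t, if_true]
        exact ⟨tierBidder_mem.2 (hcp ▸ ha), (hdead _).2 ha,
          UAP.mem_matched.2 ⟨v, Finset.mem_insert_self _ _⟩⟩
      · simp only [t, hip, if_false]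
        have hiX := (Finset.mem_filter.1 ((Finset.mem_insert.1 hi).resolve_left hip)).2.2
        obtain ⟨l, hl, hlm⟩ := hC'.last_mem_matched (hready' i) hM'
        obtain rfl : l = C'.count i - 1 := by omega
        -- More tiers are revealed in `F` than in `C'`, so this bidder is present in `F` without
        -- being the last one, hence dead.
        refine ⟨tierBidder_mem.2 (by omega), hF.not_alive (by omega), ?_⟩
        rw [tierBidder_withMan_of_ne hip] at hlm
        obtain ⟨y, hy⟩ := UAP.mem_matched.1 hlm
        refine UAP.mem_matched.2 ⟨y, Finset.mem_insert_of_mem (Finset.mem_erase.2 ⟨?_, hy⟩)⟩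
        intro h
        exact hip (manBidder_inj (Prod.mk.inj h).1).1
    obtain ⟨hbF, hbd, hb₂⟩ := hb
    have hb₁ : tierBidder Ψ I i (t i) ∉ UAP.matched M₁ := fun h => hbd ⟨M₁, hM₁, h⟩
    obtain ⟨N₁, N₂, hN₁, hN₂, hs₁, hs₂, hw, hcase⟩ :=
      UAP.exists_exchange hem₁ hem₂ hb₁ hb₂ UAP.lexEdge
    have hkey : UAP.matched N₁ ⊆ F.uap.bidders ∧ tierBidder Ψ I i (t i) ∈ UAP.matched N₁ := by
      rcases hcase with ⟨h, -⟩ | ⟨c, -, -, -, h, -⟩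
      · rw [h]
        exact ⟨Finset.insert_subset hbF hM₁.1.matched_subset, Finset.mem_insert_self _ _⟩
      · rw [h]
        exact ⟨Finset.insert_subset hbF ((Finset.erase_subset _ _).trans hM₁.1.matched_subset),
          Finset.mem_insert_self _ _⟩
    have hlt₁ := hbound₁ N₁ hN₁ hs₁ hkey.1 _ hkey.2 hbd
    -- The swap loses strictly on the side of `M₁`, so it gains on the side of `M₂`, which `hbound₂`
    -- forbids unless `N₂` matches a bidder not revealed in `C'`.
    have hnot : ¬ UAP.matched N₂ ⊆ insert u C'.uap.bidders := fun h =>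
      absurd hw (add_lt_add_of_lt_of_le hlt₁ (hbound₂ N₂ hN₂ hs₂ h)).ne
    rcases hcase with ⟨-, h⟩ | ⟨c, hc, -, hreach, -, h⟩
    · exact absurd (h ▸ (Finset.erase_subset _ _).trans hmatched₂) hnot
    · have hcC : c ∉ C'.uap.bidders := by
        intro hcC
        apply hnot
        rw [h]
        exact Finset.insert_subset (Finset.mem_insert_of_mem hcC)
          ((Finset.erase_subset _ _).trans hmatched₂)
      obtain ⟨i', l, -, rfl⟩ := mem_uap_bidders.1 (hM₁.1.matched_subset hc)
      have hl := hF.eq_last hM₁ hc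
      have hi'p : i' ≠ p := by
        rintro rfl
        exact (hdead l).1 hc
      rw [← tierBidder_withMan_of_ne hi'p R, tierBidder_mem] at hcC
      exact ⟨i', Finset.mem_filter.2 ⟨Finset.mem_univ _, hi'p, by omega⟩, l, hb₁, hreach, by omega⟩
  choose! g hgX c hg₁ hg₂ hgc using hpath
  -- Pigeonhole from `insert p X` to `X`. Paths ending at the same man end at the same bidder, his
  -- last one in `F`, so their starts would coincide.
  obtain ⟨i, hi, j, hj, hij, hgij⟩ := Finset.exists_ne_map_eq_of_card_lt_of_maps_to
    (s := insert p X) (t := X) (by rw [Finset.card_insert_of_notMem hpX]; omega) (f := g)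
    (fun i hi => hgX i hi)
  refine hij (manBidder_inj (UAP.AltReach.source_unique hem₁ hem₂ (hg₁ i hi) (hg₁ j hj)
    (hg₂ i hi) ?_)).1
  rw [hgc i hi, hgij, ← hgc j hj]
  exact hg₂ j hj

/-! ### The main theorem -/

theorem exists_config_of_toUapReturns {A : UAP (Item m n)} (h : (smiwIUAP Ψ I).ToUapReturns A) :
    ∃ C : IUAP.Config (smiwIUAP Ψ I), C.Reachable ∧ (∀ i, ¬ C.Ready i) ∧ C.uap = A := by
  obtain ⟨C, hC, hready, hA⟩ := h
  exact ⟨C, hC, ready_eq_empty_iff.1 hready, hA⟩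

theorem mem_smiwMechanism {μ : Matching (Fin m) (Fin n)} (h : μ ∈ smiwMechanism Ψ I) :
    ∃ C : IUAP.Config (smiwIUAP Ψ I), C.Reachable ∧ (∀ i, ¬ C.Ready i) ∧
      ∃ M, C.uap.IsOpt M ∧ ∀ i a, μ.man i = a ↔ tierEdge Ψ I i a ∈ M := by
  obtain ⟨A, hA, M, hM, hμ⟩ := h
  obtain ⟨C, hC, hready, rfl⟩ := exists_config_of_toUapReturns hA
  have hM := (UAP.isGreedyMWM_iff C.priority_pos).1 hM
  exact ⟨C, hC, hready, M, hM, (readOff_iff hM.1).1 hμ⟩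

theorem alwaysReturns (Ψ : UtilityAssignment (Fin m) (Fin n)) (I : Profile (Fin m) (Fin n)) :
    AlwaysReturns Ψ I := by
  refine ⟨toUapTerminates, fun A hA => ?_⟩
  obtain ⟨C, hC, hready, rfl⟩ := exists_config_of_toUapReturns hA
  simp only [UAP.isGreedyMWM_iff C.priority_pos]
  exact ⟨C.uap.exists_isOpt, fun M hM => hC.existsUnique_readOff hready hM⟩

theorem smiwMechanism_nonempty (Ψ : UtilityAssignment (Fin m) (Fin n))
    (I : Profile (Fin m) (Fin n)) : (smiwMechanism Ψ I).Nonempty := by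
  obtain ⟨C, hC, hready⟩ :=
    Reachable.exists_final (C := init (smiwIUAP Ψ I)) Relation.ReflTransGen.refl
  have hA : (smiwIUAP Ψ I).ToUapReturns C.uap :=
    ⟨C, hC, ready_eq_empty_iff.2 hready, rfl⟩
  obtain ⟨⟨M, hM⟩, h⟩ := (alwaysReturns Ψ I).2 _ hA
  obtain ⟨μ, hμ, -⟩ := h M hM
  exact ⟨μ, _, hA, M, hM, hμ⟩

theorem smiwMechanism_isParetoStable (Ψ : UtilityAssignment (Fin m) (Fin n)) :
    (smiwMechanism Ψ).IsParetoStable := by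
  refine fun I => ⟨smiwMechanism_nonempty Ψ I, fun μ hμ => ?_⟩
  obtain ⟨C, hC, -, M, hM, h⟩ := mem_smiwMechanism hμ
  exact ⟨hC.paretoOptimal hM h, hC.weaklyStable hM h⟩

theorem smiwMechanism_isStrategyproof (Ψ : UtilityAssignment (Fin m) (Fin n)) :
    (smiwMechanism Ψ).IsStrategyproof := by
  intro I p R μ hμ μ' hμ'
  obtain ⟨C, hC, -, M, hM, h⟩ := mem_smiwMechanism hμ
  obtain ⟨C', hC', hready', M', hM', h'⟩ := mem_smiwMechanism hμ'
  rw [← (I.men p).tierIndex_le_iff]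
  by_contra hlt
  have hk := hC.tierIndex_eq hM ((h p _).1 rfl)
  exact not_tierEdge_mem_of_tierIndex_lt hC hC' hready' hM' (by omega) (not_le.1 hlt)
    ((h' p _).1 rfl)

end SMIW

/-- For all numbers of men and women, utility assignments exist, and for each fixed one the
algorithm always returns a matching and is a strategyproof Pareto-stable mechanism. -/
theorem theorem1 (m n : ℕ) :
    Nonempty (SMIW.UtilityAssignment (Fin m) (Fin n)) ∧
    ∀ Ψ : SMIW.UtilityAssignment (Fin m) (Fin n),
      (∀ I : SMIW.Profile (Fin m) (Fin n), SMIW.AlwaysReturns Ψ I) ∧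
      (SMIW.smiwMechanism Ψ).IsParetoStable ∧
      (SMIW.smiwMechanism Ψ).IsStrategyproof :=
  ⟨SMIW.nonempty_utilityAssignment _ _, fun Ψ => ⟨SMIW.alwaysReturns Ψ,
    SMIW.smiwMechanism_isParetoStable Ψ, SMIW.smiwMechanism_isStrategyproof Ψ⟩⟩
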